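/- For $n\ge1$ let $f_n:\mathbb R^n\to\mathbb R$ be lower semicontinuous on the unit sphere, let $S_n=\{w\in\mathbb R^n:\|w\|_2=1,\ f_n(w)\le 0\}$, let $m=m_n<n$ be proportional to $n$ (i.e. $c\,n\le m_n<n$ for a constant $c>0$ and all large $n$), let $A$ be an $m_n\times n$ matrix with i.i.d. standard normal entries, $Y_n=\{w\in\mathbb R^n:Aw=0\}$, and let $g\in\mathbb R^n$ be a vector of i.i.d. standard normals. Put $$\xi(f_n,g)=\inf_{\lambda\ge0}\ \max_{\|w\|_2=1}\bigl(g^Tw-\lambda f_n(w)\bigr),\qquad \xi_D(f_n)=E\,\xi(f_n,g)$$ (with $\xi(f_n,g)=0$ by convention if $S_n=\emptyset$, where the infimum is $-\infty$) and $\tau(f_n,A)=\min\{f_n(w):Aw=0,\ \|w\|_2=1\}$. Assume: (a) for all large $n$ and almost every $A$, minimax duality holds for the sign of $\tau$: $\operatorname{sign}\tau(f_n,A)=\operatorname{sign}\bigl(\sup_{\nu\in\mathbb R^{m_n}}\min_{\|w\|_2=1}(f_n(w)+\nu^TAw)\bigr)$ (in particular, it suffices that the two numbers are equal); (b) $\xi$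 concentrates exponentially: for every $\varepsilon>0$ there is $\varepsilon'>0$, independent of $n$, such that for all large $n$, $P\bigl(|\xi(f_n,g)-\xi_D(f_n)|\ge\varepsilon\,\xi_D(f_n)\bigr)\le e^{-\varepsilon'\xi_D(f_n)}$. Then: (1) If there are constants $\epsilon_1,\epsilon_2>0$ independent of $n$ with $\xi_D(f_n)\ge(1+\epsilon_1)\sqrt{m_n}+\epsilon_2\sqrt n$ for all large $n$, then $\lim_{n\to\infty}P(Y_n\cap S_n\ne\emptyset)=1$. (2) If $\xi_D(f_n)<\sqrt{m_n}-\frac1{4\sqrt{m_n}}$ with a gap that tends to infinity with $n$, i.e. $\sqrt{m_n}-\frac1{4\sqrt{m_n}}-\xi_D(f_n)\to+\infty$, then $\lim_{n\to\infty}P(Y_n\cap S_n=\emptyset)=1$. -/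

import Mathlib

open Filter Topology MeasureTheory ProbabilityTheory

namespace Mesh

noncomputable section

/-- The Euclidean unit sphere of `ℝⁿ`. -/
def unitSphere (n : ℕ) : Set (EuclideanSpace ℝ (Fin n)) :=
  Metric.sphere 0 1

/-- The subset `{w : ‖w‖₂ = 1, f w ≤ 0}` of the unit sphere that is described by `f`. -/
def meshSet {n : ℕ} (f : EuclideanSpace ℝ (Fin n) → ℝ) : Set (EuclideanSpace ℝ (Fin n)) :=
  {w | w ∈ unitSphere n ∧ f w ≤ 0}

/-- The null space `{w : A w = 0}` of an `m × n` matrix. -/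
def nullSpace {m n : ℕ} (A : Matrix (Fin m) (Fin n) ℝ) : Submodule ℝ (EuclideanSpace ℝ (Fin n)) :=
  LinearMap.ker (Matrix.toEuclideanLin A)

/-- The law of an `m × n` matrix with i.i.d. standard normal entries (as a family of entries). -/
def gaussianMatrix (m n : ℕ) : Measure (Fin m → Fin n → ℝ) :=
  Measure.pi fun _ => Measure.pi fun _ => gaussianReal 0 1

/-- `τ(f, A)`: the minimum of `f` over the unit vectors `w` with `A w = 0`. -/
def tau {m n : ℕ} (f : EuclideanSpace ℝ (Fin n) → ℝ) (A : Matrix (Fin m) (Fin n) ℝ) : ℝ :=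
  sInf (f '' {w | w ∈ unitSphere n ∧ w ∈ nullSpace A})

/-- The Lagrange dual value of `τ(f, A)`:
the maximum over `ν` of the minimum over unit vectors `w` of `f w + νᵀ A w`. -/
def tauDual {m n : ℕ} (f : EuclideanSpace ℝ (Fin n) → ℝ) (A : Matrix (Fin m) (Fin n) ℝ) : ℝ :=
  ⨆ ν : EuclideanSpace ℝ (Fin m), ⨅ w : unitSphere n,
    (f w + inner ℝ ν (Matrix.toEuclideanLin A (w : EuclideanSpace ℝ (Fin n))))

/-- `ξ(f, g)`: the minimum over `l ≥ 0` of the maximum over unit vectors `w` of `gᵀ w - l f w`. -/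
def xi {n : ℕ} (f : EuclideanSpace ℝ (Fin n) → ℝ) (g : EuclideanSpace ℝ (Fin n)) : ℝ :=
  ⨅ l : Set.Ici (0 : ℝ), ⨆ w : unitSphere n,
    (inner ℝ g (w : EuclideanSpace ℝ (Fin n)) - (l : ℝ) * f w)

/-- `ξ_D(f) = E ξ(f, g)` for a vector `g` of `n` i.i.d. standard normals. -/
def xiD {n : ℕ} (f : EuclideanSpace ℝ (Fin n) → ℝ) : ℝ :=
  ∫ g, xi f g ∂(stdGaussian (EuclideanSpace ℝ (Fin n)))

/-- Minimax duality for the sign of `τ(f, A)`, for almost every `m × n` matrix `A`. -/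
def SignDuality (m : ℕ) {n : ℕ} (f : EuclideanSpace ℝ (Fin n) → ℝ) : Prop :=
  ∀ᵐ a ∂(gaussianMatrix m n),
    SignType.sign (tau f (Matrix.of a)) = SignType.sign (tauDual f (Matrix.of a))

/-- Exponential concentration of `ξ(fₙ, g)` around `ξ_D(fₙ)`, with constants that are
independent of `n`. -/
def XiConcentrates (f : (n : ℕ) → EuclideanSpace ℝ (Fin n) → ℝ) : Prop :=
  ∀ ε₁ : ℝ, 0 < ε₁ → ∃ ε₂ : ℝ, 0 < ε₂ ∧ ∀ᶠ n : ℕ in atTop,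
    (stdGaussian (EuclideanSpace ℝ (Fin n))).real
      {g | ε₁ * xiD (f n) ≤ |xi (f n) g - xiD (f n)|} ≤ Real.exp (-(ε₂ * xiD (f n)))

end

end Mesh

/-! The engine is Gordon's comparison. For unit vectors `w`, the process `(A w, z)` with an
independent scalar Gaussian `z` is compared with the decoupled process `(h, ⟪g, w⟫)`: if `ψ_w(h) ≤
⟪g, w⟫` holds for all `w` with large probability, then so does `ψ_w(A w) - 3 ≤ z`, for any
1-Lipschitz `ψ_w`. This is `measure_decoupled_le_measure_bilinear`, deduced from the rotation
argument `integral_prod_le_integral_prod`; the constant 3 pays for smoothing.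

Applied to two blocks, the same rotation argument gives a Poincaré inequality, hence Chebyshev
concentration at constant scale for Lipschitz functions. As an infimum of suprema of `⟪g, w⟫ - l
f(w)` over unit `w`, `ξ(f, ·)` is 1-Lipschitz, so `ξ`, the norm and `z` all stay within `t` of their
means up to probability `3 / t²`.

For an empty intersection, take `w` in the mesh and let `ψ` be a constant minus the norm: `⟪g, w⟫ ≤
ξ` is then well below `‖h‖ ≈ √m`, and the comparison forces `A w ≠ 0` throughout the mesh.

For a nonempty intersection, the index runs over the normalised multipliers `u = ν / ‖ν‖` and the
matrix is transposed. With `l = 1 / ‖ν‖`, the decoupled bound is `‖g‖ ≈ √m` against the inner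
maximum at `l`, which is at least `ξ`. The comparison yields, for a dense set of `ν`, a unit vector
`w` with `f w < ⟪ν, A w⟫`; so the dual value is nonpositive, and sign duality together with
compactness produces a point of the mesh in the null space. -/

namespace Mesh

/-! ### Gaussian density and integration by parts -/

section Density

variable {E : Type*} [NormedAddCommGroup E] [InnerProductSpace ℝ E] [FiniteDimensional ℝ E]
  [MeasurableSpace E] [BorelSpace E]

lemma integrable_exp_neg_half_sq_norm :
    Integrable (fun x : E => Real.exp (-(1 / 2) * ‖x‖ ^ 2)) := by
  have h := GaussianFourier.integrable_cexp_neg_mul_sq_norm_add (V := E) (b := (1 / 2 : ℂ))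
    (by norm_num) 0 0
  refine h.re.congr (ae_of_all _ fun x => ?_)
  have : (-(1 / 2 : ℂ) * (‖x‖ : ℂ) ^ 2 + 0 * ((inner ℝ (0 : E) x : ℝ) : ℂ))
      = ((-(1 / 2) * ‖x‖ ^ 2 : ℝ) : ℂ) := by
    push_cast; ring
  simp only [this]
  rw [← Complex.ofReal_exp]
  rfl

/-- The density of the standard Gaussian measure with respect to Lebesgue measure. -/
noncomputable def gaussianDensity (x : E) : ℝ :=
  (∫ y : E, Real.exp (-(1 / 2) * ‖y‖ ^ 2))⁻¹ * Real.exp (-(1 / 2) * ‖x‖ ^ 2)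

lemma integral_exp_neg_half_sq_norm_pos :
    0 < ∫ y : E, Real.exp (-(1 / 2) * ‖y‖ ^ 2) := by
  rw [GaussianFourier.integral_rexp_neg_mul_sq_norm (by norm_num)]
  positivity

lemma gaussianDensity_nonneg (x : E) : 0 ≤ gaussianDensity x :=
  mul_nonneg (inv_nonneg.2 integral_exp_neg_half_sq_norm_pos.le) (Real.exp_pos _).le

lemma continuous_gaussianDensity : Continuous (gaussianDensity : E → ℝ) := by
  unfold gaussianDensity
  fun_prop

lemma integrable_gaussianDensity : Integrable (gaussianDensity : E → ℝ) :=
  integrable_exp_neg_half_sq_norm.const_mul _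

lemma integral_gaussianDensity : ∫ x : E, gaussianDensity x = 1 := by
  unfold gaussianDensity
  rw [integral_const_mul]
  exact inv_mul_cancel₀ integral_exp_neg_half_sq_norm_pos.ne'

/-- Characteristic functions agree: the Gaussian Fourier integral at frequency zero is the
normalising constant, so it cancels from the one at `t`. The density form gives access to
integration by parts for Lebesgue measure. -/
lemma stdGaussian_eq_withDensity :
    stdGaussian E = (volume : Measure E).withDensity
      (fun x => ((gaussianDensity x).toNNReal : ENNReal)) := by
  have hprob : IsProbabilityMeasure ((volume : Measure E).withDensity
      (fun x => ((gaussianDensity x).toNNReal : ENNReal))) := by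
    constructor
    rw [withDensity_apply _ MeasurableSet.univ, Measure.restrict_univ]
    have := ofReal_integral_eq_lintegral_ofReal (integrable_gaussianDensity (E := E))
      (ae_of_all _ gaussianDensity_nonneg)
    rw [integral_gaussianDensity, ENNReal.ofReal_one] at this
    exact this.symm
  apply Measure.ext_of_charFun
  ext t
  rw [charFun_stdGaussian, charFun_apply, integral_withDensity_eq_integral_smul
    (continuous_gaussianDensity.measurable.real_toNNReal)]
  have h := GaussianFourier.integral_cexp_neg_mul_sq_norm_add (V := E) (b := (1 / 2 : ℂ))
    (by norm_num) Complex.I t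
  have h0 := GaussianFourier.integral_cexp_neg_mul_sq_norm_add (V := E) (b := (1 / 2 : ℂ))
    (by norm_num) 0 0
  have hI : ((∫ y : E, Real.exp (-(1 / 2) * ‖y‖ ^ 2) : ℝ) : ℂ)
      = ((Real.pi : ℂ) / (1 / 2)) ^ ((Module.finrank ℝ E : ℂ) / 2) := by
    rw [← integral_complex_ofReal]
    simp only [norm_zero, zero_mul, add_zero] at h0
    norm_num at h0 ⊢
    exact h0
  have hne : ((∫ y : E, Real.exp (-(1 / 2) * ‖y‖ ^ 2) : ℝ) : ℂ) ≠ 0 := by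
    exact_mod_cast (integral_exp_neg_half_sq_norm_pos (E := E)).ne'
  have : ∀ x : E, (gaussianDensity x).toNNReal • Complex.exp ((inner ℝ x t : ℝ) * Complex.I)
      = ((∫ y : E, Real.exp (-(1 / 2) * ‖y‖ ^ 2) : ℝ) : ℂ)⁻¹ *
        Complex.exp (-(1 / 2 : ℂ) * ‖x‖ ^ 2 + Complex.I * (inner ℝ t x : ℝ)) := by
    intro x
    rw [NNReal.smul_def, Real.coe_toNNReal _ (gaussianDensity_nonneg x), gaussianDensity,
      Complex.exp_add, real_inner_comm, Complex.real_smul]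
    push_cast
    rw [mul_comm Complex.I]
    ring
  simp_rw [this]
  rw [integral_const_mul, h, ← hI, ← mul_assoc, inv_mul_cancel₀ hne, one_mul]
  congr 1
  rw [Complex.I_sq]
  ring

/-- Gaussian integration by parts along a direction `v`. -/
lemma integral_inner_mul_stdGaussian {F F' : E → ℝ} {v : E} (hF : Continuous F)
    (hF' : Continuous F') {B : ℝ} (hB : ∀ x, |F x| ≤ B) (hB' : ∀ x, |F' x| ≤ B)
    (hd : ∀ x, HasLineDerivAt ℝ F (F' x) x v) :
    ∫ x, inner ℝ v x * F x ∂(stdGaussian E) = ∫ x, F' x ∂(stdGaussian E) := by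
  have key : ∀ G : E → ℝ, ∫ x, G x ∂(stdGaussian E) = ∫ x, gaussianDensity x * G x := by
    intro G
    rw [stdGaussian_eq_withDensity, integral_withDensity_eq_integral_smul
      (continuous_gaussianDensity.measurable.real_toNNReal)]
    refine integral_congr_ae (ae_of_all _ fun x => ?_)
    simp only [NNReal.smul_def, Real.coe_toNNReal _ (gaussianDensity_nonneg x), smul_eq_mul]
  have hint : Integrable (fun x : E => inner ℝ v x * gaussianDensity x) := by
    have h1 : Integrable (fun x : E => inner ℝ v x) (stdGaussian E) :=
      (innerSL ℝ v).integrable_comp IsGaussian.integrable_id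
    rw [stdGaussian_eq_withDensity, integrable_withDensity_iff_integrable_smul
      (continuous_gaussianDensity.measurable.real_toNNReal)] at h1
    refine h1.congr (ae_of_all _ fun x => ?_)
    simp only [NNReal.smul_def, Real.coe_toNNReal _ (gaussianDensity_nonneg x), smul_eq_mul]
    ring
  -- The logarithmic derivative of the density along `v` is `-⟪v, x⟫`; this is the source of the
  -- factor `⟪v, x⟫`.
  have hρ : ∀ x : E, HasLineDerivAt ℝ gaussianDensity (-(inner ℝ v x * gaussianDensity x)) x v := by
    intro x
    have h1 : HasFDerivAt (fun x : E => ‖x‖ ^ 2) (2 • innerSL ℝ x) x :=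
      (hasStrictFDerivAt_norm_sq x).hasFDerivAt
    have h2 := ((h1.const_mul (-(1 / 2) : ℝ)).exp.const_mul
      (∫ y : E, Real.exp (-(1 / 2) * ‖y‖ ^ 2))⁻¹).hasLineDerivAt v
    convert! h2 using 1
    simp only [gaussianDensity, _root_.smul_apply, smul_eq_mul, innerSL_apply_apply,
      nsmul_eq_mul, real_inner_comm v x]
    push_cast
    ring
  rw [key, key]
  have := integral_bilinear_hasLineDerivAt_right_eq_neg_left_of_integrable (μ := volume)
    (f := gaussianDensity) (f' := fun x : E => -(inner ℝ v x * gaussianDensity x)) (g := F) (g' := F')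
    (v := v) (B := ContinuousLinearMap.mul ℝ ℝ) ?_ ?_ ?_ (fun x _ => hρ x) (fun x _ => hd x)
  · simp only [ContinuousLinearMap.mul_apply'] at this
    rw [this, ← integral_neg]
    refine integral_congr_ae (ae_of_all _ fun x => ?_)
    simp only
    ring
  · exact hint.neg.mul_bdd (c := B) hF.aestronglyMeasurable (ae_of_all _ hB)
  · exact integrable_gaussianDensity.mul_bdd (c := B) hF'.aestronglyMeasurable (ae_of_all _ hB')
  · exact integrable_gaussianDensity.mul_bdd (c := B) hF.aestronglyMeasurable (ae_of_all _ hB)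

end Density

/-! ### Gaussian interpolation by rotation -/

section Interpolation

variable {J K : Type*} [Fintype J] [DecidableEq J] [Fintype K]

omit [Fintype J] in
lemma hasDerivAt_prod_comp {φ : J → (K → ℝ) → ℝ} {φ' : J → (K → ℝ) → K → ℝ}
    (hφ : ∀ j x, HasFDerivAt (φ j)
      (∑ k, φ' j x k • ContinuousLinearMap.proj (R := ℝ) (φ := fun _ : K => ℝ) k) x)
    (s : Finset J) {γ : J → ℝ → K → ℝ} {γ' : J → K → ℝ} {t₀ : ℝ}
    (hγ : ∀ j k, HasDerivAt (fun t => γ j t k) (γ' j k) t₀) :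
    HasDerivAt (fun t => ∏ j ∈ s, φ j (γ j t))
      (∑ j ∈ s, (∏ i ∈ s.erase j, φ i (γ i t₀)) * ∑ k, φ' j (γ j t₀) k * γ' j k) t₀ := by
  refine HasDerivAt.fun_finsetProd fun j _ => ?_
  have h := (hφ j (γ j t₀)).comp_hasDerivAt t₀ (hasDerivAt_pi.2 (hγ j))
  convert! h using 1
  simp

variable {E : Type*} [NormedAddCommGroup E] [InnerProductSpace ℝ E]

/-- The rotation `cos θ • p + sin θ • q` of two families of vectors. -/
noncomputable def rot (p q : J → K → E) (θ : ℝ) (j : J) (k : K) : E :=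
  Real.cos θ • p j k + Real.sin θ • q j k

/-- The derivative of `rot p q` in the angle. -/
noncomputable def rotDeriv (p q : J → K → E) (θ : ℝ) (j : J) (k : K) : E :=
  (-Real.sin θ) • p j k + Real.cos θ • q j k

/-- The coordinates of `G` along a family of vectors. -/
noncomputable def coords (v : J → K → E) (j : J) (G : E) (k : K) : ℝ := inner ℝ (v j k) G

omit [Fintype J] [DecidableEq J] [Fintype K] in
lemma continuous_coords (v : J → K → E) (j : J) : Continuous (coords v j) := by
  unfold coords
  fun_prop

omit [Fintype J] [DecidableEq J] [Fintype K] in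
lemma hasDerivAt_coords_rot (p q : J → K → E) (G : E) (j : J) (k : K) (θ : ℝ) :
    HasDerivAt (fun t => coords (rot p q t) j G k) (coords (rotDeriv p q θ) j G k) θ := by
  unfold coords rot rotDeriv
  simp only [inner_add_left, real_inner_smul_left]
  exact ((Real.hasDerivAt_cos θ).mul_const _).add ((Real.hasDerivAt_sin θ).mul_const _)

omit [Fintype J] [DecidableEq J] [Fintype K] in
lemma inner_rot_rotDeriv {p q : J → K → E} (hpq : ∀ j k l k', inner ℝ (p j k) (q l k') = 0)
    (θ : ℝ) (j l : J) (k k' : K) :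
    inner ℝ (rot p q θ l k') (rotDeriv p q θ j k) = Real.sin θ * Real.cos θ *
      (inner ℝ (q l k') (q j k) - inner ℝ (p l k') (p j k)) := by
  have hqp : inner ℝ (q l k') (p j k) = 0 := by rw [real_inner_comm]; exact hpq _ _ _ _
  simp only [rot, rotDeriv, inner_add_left, inner_add_right, real_inner_smul_left,
    real_inner_smul_right, hpq, hqp]
  ring

omit [Fintype J] [DecidableEq J] [Fintype K] in
lemma norm_rotDeriv_le (p q : J → K → E) (θ : ℝ) (j : J) (k : K) :
    ‖rotDeriv p q θ j k‖ ≤ ‖p j k‖ + ‖q j k‖ := by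
  refine (norm_add_le _ _).trans (add_le_add ?_ ?_) <;> rw [norm_smul, Real.norm_eq_abs]
  · rw [abs_neg]; exact mul_le_of_le_one_left (norm_nonneg _) (Real.abs_sin_le_one _)
  · exact mul_le_of_le_one_left (norm_nonneg _) (Real.abs_cos_le_one _)

variable [FiniteDimensional ℝ E] [MeasurableSpace E] [BorelSpace E]

omit [Fintype J] [DecidableEq J] [Fintype K] in
lemma abs_prod_le_pow {φ : J → (K → ℝ) → ℝ} {B : ℝ} (hb : ∀ j x, |φ j x| ≤ B) (s : Finset J)
    (x : J → K → ℝ) : |∏ i ∈ s, φ i (x i)| ≤ B ^ s.card := by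
  rw [Finset.abs_prod]
  refine (Finset.prod_le_prod (fun i _ => abs_nonneg _) (fun i _ => hb i _)).trans_eq ?_
  rw [Finset.prod_const]

omit [Fintype K] [FiniteDimensional ℝ E] [MeasurableSpace E] [BorelSpace E] [DecidableEq J]
  [Fintype J] in
lemma continuous_prod_coords {φ : J → (K → ℝ) → ℝ} (hφ : ∀ j, Continuous (φ j))
    (s : Finset J) (v : J → K → E) : Continuous fun G => ∏ i ∈ s, φ i (coords v i G) :=
  continuous_finsetProd _ fun i _ => (hφ i).comp (continuous_coords v i)

/-- Gaussian integration by parts for one coordinate of the derivative of the interpolation. -/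
lemma integral_coords_mul_prod {φ : J → (K → ℝ) → ℝ} {φ' : J → (K → ℝ) → K → ℝ}
    (hφ : ∀ j x, HasFDerivAt (φ j)
      (∑ k, φ' j x k • ContinuousLinearMap.proj (R := ℝ) (φ := fun _ : K => ℝ) k) x)
    (hc : ∀ j k, Continuous fun x => φ' j x k) {B : ℝ}
    (hb : ∀ j x, |φ j x| ≤ B) (hb' : ∀ j x k, |φ' j x k| ≤ B)
    {v : J → K → E} {w : E} {j : J} (hw : ∀ k, inner ℝ (v j k) w = 0) (k : K) :
    ∫ G, inner ℝ w G * (φ' j (coords v j G) k *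
        ∏ i ∈ Finset.univ.erase j, φ i (coords v i G)) ∂(stdGaussian E) =
      ∫ G, φ' j (coords v j G) k * ∑ l ∈ Finset.univ.erase j,
        (∏ i ∈ (Finset.univ.erase j).erase l, φ i (coords v i G)) *
          ∑ k', φ' l (coords v l G) k' * inner ℝ (v l k') w ∂(stdGaussian E) := by
  have hφc : ∀ j, Continuous (φ j) := fun j =>
    continuous_iff_continuousAt.2 fun x => (hφ j x).continuousAt
  have hcc : ∀ l k, Continuous fun G => φ' l (coords v l G) k := fun l k =>
    (hc l k).comp (continuous_coords v l)
  have hB : 0 ≤ B := (abs_nonneg _).trans (hb j 0)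
  set C₁ : ℝ := B * B ^ (Finset.univ.erase j).card with hC₁
  set C₂ : ℝ := B * ∑ l ∈ Finset.univ.erase j, B ^ ((Finset.univ.erase j).erase l).card *
    ∑ k', B * |inner ℝ (v l k') w| with hC₂
  refine integral_inner_mul_stdGaussian (B := max C₁ C₂) ?_ ?_ ?_ ?_ ?_
  · exact (hcc j k).mul (continuous_prod_coords hφc _ v)
  · refine (hcc j k).mul (continuous_finsetSum _ fun l _ => ?_)
    exact (continuous_prod_coords hφc _ v).mul (continuous_finsetSum _ fun k' _ =>
      (hcc l k').mul continuous_const)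
  · intro G
    refine le_trans ?_ (le_max_left _ _)
    rw [abs_mul]
    exact mul_le_mul (hb' j _ k) (abs_prod_le_pow hb _ _) (abs_nonneg _) hB
  · intro G
    refine le_trans ?_ (le_max_right _ _)
    rw [abs_mul]
    refine mul_le_mul (hb' j _ k) ((Finset.abs_sum_le_sum_abs _ _).trans
      (Finset.sum_le_sum fun l _ => ?_)) (abs_nonneg _) hB
    rw [abs_mul]
    refine mul_le_mul (abs_prod_le_pow hb _ _) ((Finset.abs_sum_le_sum_abs _ _).trans
      (Finset.sum_le_sum fun k' _ => ?_)) (abs_nonneg _) (pow_nonneg hB _)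
    rw [abs_mul]
    exact mul_le_mul_of_nonneg_right (hb' l _ k') (abs_nonneg _)
  · intro G
    -- Since `w` is orthogonal to block `j`, the factor `φ' j` is constant along the line. No second
    -- derivative of `φ j` appears, so C¹ regularity suffices.
    have hconst : ∀ t : ℝ, coords v j (G + t • w) = coords v j G := by
      intro t
      ext k'
      simp [coords, inner_add_right, real_inner_smul_right, hw]
    have hline : ∀ l k', HasDerivAt (fun t : ℝ => coords v l (G + t • w) k')
        (inner ℝ (v l k') w) 0 := by
      intro l k'
      simp only [coords, inner_add_right, real_inner_smul_right]
      simpa using ((hasDerivAt_id (0 : ℝ)).mul_const (inner ℝ (v l k') w)).const_add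
        (inner ℝ (v l k') G)
    have h := (hasDerivAt_prod_comp hφ (Finset.univ.erase j) hline).const_mul
      (φ' j (coords v j G) k)
    simp only [zero_smul, add_zero] at h
    unfold HasLineDerivAt
    simp only [hconst]
    exact h

/-- The Gaussian interpolation inequality. Two families of blocks of jointly Gaussian coordinates
have the same covariances inside each block; the expected product of functions of the blocks
is compared through the sign of the mixed second derivatives. -/
theorem integral_prod_le_integral_prod {φ : J → (K → ℝ) → ℝ} {φ' : J → (K → ℝ) → K → ℝ}
    (hφ : ∀ j x, HasFDerivAt (φ j)
      (∑ k, φ' j x k • ContinuousLinearMap.proj (R := ℝ) (φ := fun _ : K => ℝ) k) x)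
    (hc : ∀ j k, Continuous fun x => φ' j x k) {B : ℝ}
    (hb : ∀ j x, |φ j x| ≤ B) (hb' : ∀ j x k, |φ' j x k| ≤ B)
    {p q : J → K → E} (hpq : ∀ j k l k', inner ℝ (p j k) (q l k') = 0)
    (hcov : ∀ j k k', inner ℝ (p j k) (p j k') = inner ℝ (q j k) (q j k')) {C : ℝ}
    (hC : ∀ x : J → K → ℝ, -C ≤ ∑ j, ∑ l ∈ Finset.univ.erase j,
      (∏ i ∈ (Finset.univ.erase j).erase l, φ i (x i)) * ∑ k, ∑ k',
        (inner ℝ (q l k') (q j k) - inner ℝ (p l k') (p j k)) *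
          (φ' j (x j) k * φ' l (x l) k')) :
    ∫ G, ∏ j, φ j (coords p j G) ∂(stdGaussian E) - C / 2 ≤
      ∫ G, ∏ j, φ j (coords q j G) ∂(stdGaussian E) := by
  have hφc : ∀ j, Continuous (φ j) := fun j =>
    continuous_iff_continuousAt.2 fun x => (hφ j x).continuousAt
  rcases isEmpty_or_nonempty J with hJ | ⟨⟨j₀⟩⟩
  · have := hC (fun j => isEmptyElim j)
    simp at this ⊢
    linarith
  have hB : 0 ≤ B := (abs_nonneg _).trans (hb j₀ 0)
  set D : ℝ → E → ℝ := fun θ G => ∑ j, (∏ i ∈ Finset.univ.erase j,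
    φ i (coords (rot p q θ) i G)) * ∑ k, φ' j (coords (rot p q θ) j G) k *
      coords (rotDeriv p q θ) j G k with hD
  set R : ℝ := ∑ j : J, B ^ (Finset.univ.erase j).card * ∑ k, B * (‖p j k‖ + ‖q j k‖) with hR
  have hnorm : Integrable (fun G : E => ‖G‖) (stdGaussian E) := IsGaussian.integrable_id.norm
  have hDbound : ∀ θ G, |D θ G| ≤ R * ‖G‖ := by
    intro θ G
    rw [hD, hR, Finset.sum_mul]
    refine (Finset.abs_sum_le_sum_abs _ _).trans (Finset.sum_le_sum fun j _ => ?_)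
    rw [abs_mul, mul_assoc, Finset.sum_mul]
    refine mul_le_mul (abs_prod_le_pow hb _ _) ((Finset.abs_sum_le_sum_abs _ _).trans
      (Finset.sum_le_sum fun k _ => ?_)) (abs_nonneg _) (pow_nonneg hB _)
    rw [abs_mul, mul_assoc]
    refine mul_le_mul (hb' j _ k) ?_ (abs_nonneg _) hB
    exact (abs_real_inner_le_norm _ _).trans
      (mul_le_mul_of_nonneg_right (norm_rotDeriv_le p q θ j k) (norm_nonneg _))
  have hterm : ∀ θ j k, Continuous fun G : E =>
      inner ℝ (rotDeriv p q θ j k) G * (φ' j (coords (rot p q θ) j G) k *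
        ∏ i ∈ Finset.univ.erase j, φ i (coords (rot p q θ) i G)) := fun θ j k =>
    ((continuous_const.inner continuous_id)).mul
      (((hc j k).comp (continuous_coords _ j)).mul (continuous_prod_coords hφc _ _))
  have hDeq : ∀ θ G, D θ G = ∑ j, ∑ k, inner ℝ (rotDeriv p q θ j k) G *
      (φ' j (coords (rot p q θ) j G) k *
        ∏ i ∈ Finset.univ.erase j, φ i (coords (rot p q θ) i G)) := by
    intro θ G
    refine Finset.sum_congr rfl fun j _ => ?_
    rw [Finset.mul_sum]
    refine Finset.sum_congr rfl fun k _ => ?_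
    rw [coords]
    ring
  have hDcont : ∀ θ, Continuous (D θ) := by
    intro θ
    rw [funext (hDeq θ)]
    exact continuous_finsetSum _ fun j _ => continuous_finsetSum _ fun k _ => hterm θ j k
  have hderiv : ∀ θ, HasDerivAt
      (fun θ => ∫ G, ∏ j, φ j (coords (rot p q θ) j G) ∂(stdGaussian E))
      (∫ G, D θ G ∂(stdGaussian E)) θ := by
    intro θ
    refine (hasDerivAt_integral_of_dominated_loc_of_deriv_le (s := Set.univ)
      (bound := fun G => R * ‖G‖) Filter.univ_mem
      (Eventually.of_forall fun t =>
        (continuous_prod_coords hφc _ (rot p q t)).aestronglyMeasurable) ?_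
      (hDcont θ).aestronglyMeasurable (ae_of_all _ fun G t _ => hDbound t G)
      (hnorm.const_mul R) (ae_of_all _ fun G t _ => ?_)).2
    · exact Integrable.of_bound (continuous_prod_coords hφc _ (rot p q θ)).aestronglyMeasurable _
        (ae_of_all _ fun G => abs_prod_le_pow hb _ _)
    · exact hasDerivAt_prod_comp hφ Finset.univ fun j k => hasDerivAt_coords_rot p q G j k t
  have hterm_int : ∀ θ j k, Integrable (fun G : E =>
      inner ℝ (rotDeriv p q θ j k) G * (φ' j (coords (rot p q θ) j G) k *
        ∏ i ∈ Finset.univ.erase j, φ i (coords (rot p q θ) i G))) (stdGaussian E) := by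
    intro θ j k
    refine (hnorm.const_mul (‖rotDeriv p q θ j k‖ *
      (B * B ^ (Finset.univ.erase j).card))).mono' (hterm θ j k).aestronglyMeasurable
      (ae_of_all _ fun G => ?_)
    rw [Real.norm_eq_abs, abs_mul, abs_mul]
    have h1 := abs_real_inner_le_norm (rotDeriv p q θ j k) G
    have h2 := mul_le_mul (hb' j (coords (rot p q θ) j G) k)
      (abs_prod_le_pow hb (Finset.univ.erase j) fun i => coords (rot p q θ) i G) (abs_nonneg _) hB
    calc _ ≤ ‖rotDeriv p q θ j k‖ * ‖G‖ * (B * B ^ (Finset.univ.erase j).card) :=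
          mul_le_mul h1 h2 (by positivity) (by positivity)
      _ = _ := by ring
  have hDint : ∀ θ, 0 ≤ Real.sin θ * Real.cos θ →
      -C * (Real.sin θ * Real.cos θ) ≤ ∫ G, D θ G ∂(stdGaussian E) := by
    intro θ hθ
    -- Equal covariances inside a block make the velocity of the rotation orthogonal to its own
    -- block; only pairs of distinct blocks contribute to the derivative.
    have horth : ∀ j k k', inner ℝ (rot p q θ j k') (rotDeriv p q θ j k) = 0 := by
      intro j k k'
      rw [inner_rot_rotDeriv hpq, hcov, sub_self, mul_zero]
    have hF'cont : ∀ j k, Continuous fun G : E => φ' j (coords (rot p q θ) j G) k *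
        ∑ l ∈ Finset.univ.erase j,
          (∏ i ∈ (Finset.univ.erase j).erase l, φ i (coords (rot p q θ) i G)) *
          ∑ k', φ' l (coords (rot p q θ) l G) k' *
            inner ℝ (rot p q θ l k') (rotDeriv p q θ j k) := fun j k =>
      ((hc j k).comp (continuous_coords _ j)).mul (continuous_finsetSum _ fun l _ =>
        (continuous_prod_coords hφc _ _).mul (continuous_finsetSum _ fun k' _ =>
          ((hc l k').comp (continuous_coords _ l)).mul continuous_const))
    have hF'int : ∀ j k, Integrable (fun G : E => φ' j (coords (rot p q θ) j G) k *
        ∑ l ∈ Finset.univ.erase j,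
          (∏ i ∈ (Finset.univ.erase j).erase l, φ i (coords (rot p q θ) i G)) *
          ∑ k', φ' l (coords (rot p q θ) l G) k' *
            inner ℝ (rot p q θ l k') (rotDeriv p q θ j k)) (stdGaussian E) := by
      intro j k
      refine Integrable.of_bound (hF'cont j k).aestronglyMeasurable
        (B * ∑ l ∈ Finset.univ.erase j, B ^ ((Finset.univ.erase j).erase l).card *
          ∑ k', B * |inner ℝ (rot p q θ l k') (rotDeriv p q θ j k)|) (ae_of_all _ fun G => ?_)
      rw [Real.norm_eq_abs, abs_mul]
      refine mul_le_mul (hb' j _ k) ((Finset.abs_sum_le_sum_abs _ _).trans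
        (Finset.sum_le_sum fun l _ => ?_)) (abs_nonneg _) hB
      rw [abs_mul]
      refine mul_le_mul (abs_prod_le_pow hb _ _) ((Finset.abs_sum_le_sum_abs _ _).trans
        (Finset.sum_le_sum fun k' _ => ?_)) (abs_nonneg _) (pow_nonneg hB _)
      rw [abs_mul]
      exact mul_le_mul_of_nonneg_right (hb' l _ k') (abs_nonneg _)
    calc -C * (Real.sin θ * Real.cos θ)
        = ∫ _G : E, -C * (Real.sin θ * Real.cos θ) ∂(stdGaussian E) := by simp
      _ ≤ ∫ G, ∑ j, ∑ k, φ' j (coords (rot p q θ) j G) k * ∑ l ∈ Finset.univ.erase j,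
          (∏ i ∈ (Finset.univ.erase j).erase l, φ i (coords (rot p q θ) i G)) *
          ∑ k', φ' l (coords (rot p q θ) l G) k' *
            inner ℝ (rot p q θ l k') (rotDeriv p q θ j k) ∂(stdGaussian E) := by
        refine integral_mono (integrable_const _) (integrable_finsetSum _ fun j _ =>
          integrable_finsetSum _ fun k _ => hF'int j k) fun G => ?_
        refine (mul_le_mul_of_nonneg_right (hC fun j => coords (rot p q θ) j G) hθ).trans_eq ?_
        rw [Finset.sum_mul]
        refine Finset.sum_congr rfl fun j _ => ?_
        simp only [inner_rot_rotDeriv hpq, Finset.mul_sum, Finset.sum_mul]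
        rw [Finset.sum_comm]
        refine Finset.sum_congr rfl fun k _ => ?_
        refine Finset.sum_congr rfl fun l _ => ?_
        refine Finset.sum_congr rfl fun k' _ => ?_
        ring
      _ = ∫ G, D θ G ∂(stdGaussian E) := by
        rw [funext (hDeq θ), integral_finsetSum _ fun j _ =>
          integrable_finsetSum _ fun k _ => hF'int j k, integral_finsetSum _ fun j _ =>
          integrable_finsetSum _ fun k _ => hterm_int θ j k]
        refine Finset.sum_congr rfl fun j _ => ?_
        rw [integral_finsetSum _ fun k _ => hF'int j k,
          integral_finsetSum _ fun k _ => hterm_int θ j k]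
        exact Finset.sum_congr rfl fun k _ =>
          (integral_coords_mul_prod hφ hc hb hb' (horth j k) k).symm
  -- The derivative of the expectation is at least `-C sin θ cos θ`; the added term compensates
  -- exactly and contributes `C / 2` over the quarter turn.
  have hmono : MonotoneOn (fun θ => (∫ G, ∏ j, φ j (coords (rot p q θ) j G) ∂(stdGaussian E)) +
      C / 2 * Real.sin θ ^ 2) (Set.Icc 0 (Real.pi / 2)) := by
    have hd : ∀ θ, HasDerivAt (fun θ =>
        (∫ G, ∏ j, φ j (coords (rot p q θ) j G) ∂(stdGaussian E)) + C / 2 * Real.sin θ ^ 2)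
        ((∫ G, D θ G ∂(stdGaussian E)) + C / 2 * (2 * Real.sin θ * Real.cos θ)) θ := by
      intro θ
      refine (hderiv θ).add (HasDerivAt.const_mul _ ?_)
      simpa using (Real.hasDerivAt_sin θ).fun_pow 2
    refine monotoneOn_of_deriv_nonneg (convex_Icc _ _)
      (fun θ _ => (hd θ).continuousAt.continuousWithinAt)
      (fun θ _ => (hd θ).differentiableAt.differentiableWithinAt) fun θ hθ => ?_
    rw [interior_Icc] at hθ
    rw [(hd θ).deriv]
    have hs := Real.sin_nonneg_of_nonneg_of_le_pi hθ.1.le (by linarith [hθ.2, Real.pi_pos])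
    have hcos := Real.cos_nonneg_of_neg_pi_div_two_le_of_le (by linarith [hθ.1, Real.pi_pos])
      hθ.2.le
    have := hDint θ (mul_nonneg hs hcos)
    linarith
  have h := hmono (Set.left_mem_Icc.2 (by positivity)) (Set.right_mem_Icc.2 (by positivity))
    (by positivity)
  have h0 : rot p q 0 = p := by ext j k; simp [rot]
  have h1 : rot p q (Real.pi / 2) = q := by ext j k; simp [rot]
  simp only [h0, h1, Real.sin_zero, Real.sin_pi_div_two] at h
  linarith

end Interpolation

/-! ### Smoothing Lipschitz functions -/

section Mollification

open scoped Convolution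

variable {F : Type*} [NormedAddCommGroup F] [InnerProductSpace ℝ F] [FiniteDimensional ℝ F]

/-- A `1`-Lipschitz function is a uniform limit of continuously differentiable `1`-Lipschitz
functions. -/
theorem exists_contDiff_lipschitz_approx {ψ : F → ℝ} (hψ : LipschitzWith 1 ψ) {δ : ℝ}
    (hδ : 0 < δ) :
    ∃ ψ' : F → ℝ, ContDiff ℝ 1 ψ' ∧ LipschitzWith 1 ψ' ∧ ∀ x, |ψ' x - ψ x| ≤ δ := by
  borelize F
  -- Convolution averages translates of `ψ`, which keeps the Lipschitz constant; a kernel supported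
  -- within radius `δ` moves values by at most `δ`.
  let ρ : ContDiffBump (0 : F) := ⟨δ / 2, δ, by positivity, by linarith⟩
  have hloc : LocallyIntegrable ψ (volume : Measure F) := hψ.continuous.locallyIntegrable
  have hconv : ∀ x, Integrable (fun t => ρ.normed volume t * ψ (x - t)) := by
    intro x
    refine (ρ.continuous_normed.mul (hψ.continuous.comp
      (continuous_const.sub continuous_id))).integrable_of_hasCompactSupport ?_
    exact ρ.hasCompactSupport_normed.mul_right
  have hval : ∀ x, (ρ.normed volume ⋆[ContinuousLinearMap.lsmul ℝ ℝ, volume] ψ) x =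
      ∫ t, ρ.normed volume t * ψ (x - t) := fun x => rfl
  refine ⟨ρ.normed volume ⋆[ContinuousLinearMap.lsmul ℝ ℝ, volume] ψ, ?_, ?_, fun x => ?_⟩
  · exact ρ.hasCompactSupport_normed.contDiff_convolution_left (n := 1) _ ρ.contDiff_normed hloc
  · refine LipschitzWith.of_le_add fun x y => ?_
    have hρ : Integrable (fun t => ρ.normed (volume : Measure F) t) := ρ.integrable_normed
    calc (ρ.normed volume ⋆[ContinuousLinearMap.lsmul ℝ ℝ, volume] ψ) x
        = ∫ t, ρ.normed volume t * ψ (x - t) := hval x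
      _ ≤ ∫ t, (ρ.normed volume t * ψ (y - t) + ρ.normed volume t * dist x y) := by
          refine integral_mono (hconv x) ((hconv y).add (hρ.mul_const _)) fun t => ?_
          simp only
          rw [← mul_add]
          refine mul_le_mul_of_nonneg_left ?_ (ρ.nonneg_normed t)
          have := hψ.le_add_mul (x - t) (y - t)
          simpa using this
      _ = _ := by
          rw [integral_add (hconv y) (hρ.mul_const _), integral_mul_const, ρ.integral_normed,
            one_mul, hval]
  · refine ContDiffBump.dist_normed_convolution_le hψ.continuous.aestronglyMeasurable
      fun y hy => ?_
    have h1 := hψ.dist_le_mul y x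
    have h2 : dist y x < δ := hy
    simp only [NNReal.coe_one, one_mul] at h1
    linarith

end Mollification

/-! ### Partial derivatives of Lipschitz functions -/

section Gradient

variable {ι : Type*} [Fintype ι] [DecidableEq ι]

/-- The partial derivatives of a function on Euclidean space. -/
noncomputable def partials (ψ : EuclideanSpace ℝ ι → ℝ) (x : ι → ℝ) (k : ι) : ℝ :=
  fderiv ℝ ψ (WithLp.toLp 2 x) (EuclideanSpace.single k 1)

lemma continuous_partials {ψ : EuclideanSpace ℝ ι → ℝ} (hψ : ContDiff ℝ 1 ψ) (k : ι) :
    Continuous fun x => partials ψ x k := by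
  unfold partials
  have h : Continuous (fderiv ℝ ψ) := hψ.continuous_fderiv one_ne_zero
  have h2 : Continuous fun x : ι → ℝ => (WithLp.toLp 2 x : EuclideanSpace ℝ ι) := by fun_prop
  exact (h.comp h2).clm_apply continuous_const

/-- Cauchy–Schwarz for two gradients of norm at most one. This is the only input on Lipschitz
functions in the sign conditions of the interpolation. -/
lemma abs_sum_partials_mul_le {ψ₁ ψ₂ : EuclideanSpace ℝ ι → ℝ} (h₁ : LipschitzWith 1 ψ₁)
    (h₂ : LipschitzWith 1 ψ₂) (x y : ι → ℝ) :
    |∑ k, partials ψ₁ x k * partials ψ₂ y k| ≤ 1 := by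
  have key : ∀ {ψ : EuclideanSpace ℝ ι → ℝ}, LipschitzWith 1 ψ → ∀ x : ι → ℝ,
      ∑ k, partials ψ x k ^ 2 ≤ 1 := by
    intro ψ h x
    have h1 : ‖fderiv ℝ ψ (WithLp.toLp 2 x)‖ ≤ 1 := by
      simpa using norm_fderiv_le_of_lipschitz ℝ h
    have h2 := (EuclideanSpace.basisFun ι ℝ).norm_dual (fderiv ℝ ψ (WithLp.toLp 2 x))
    have h3 : ∑ k, partials ψ x k ^ 2 = ‖fderiv ℝ ψ (WithLp.toLp 2 x)‖ ^ 2 := by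
      rw [h2]
      exact Finset.sum_congr rfl fun k _ => by simp [partials]
    rw [h3]
    nlinarith [norm_nonneg (fderiv ℝ ψ (WithLp.toLp 2 x))]
  rw [← sq_le_one_iff_abs_le_one]
  refine (Finset.sum_mul_sq_le_sq_mul_sq _ _ _).trans ?_
  exact mul_le_one₀ (key h₁ x) (Finset.sum_nonneg fun _ _ => sq_nonneg _) (key h₂ y)

lemma abs_partials_le {ψ : EuclideanSpace ℝ ι → ℝ} (h : LipschitzWith 1 ψ) (x : ι → ℝ) (k : ι) :
    |partials ψ x k| ≤ 1 := by
  have h1 : ‖fderiv ℝ ψ (WithLp.toLp 2 x)‖ ≤ 1 := by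
    simpa using norm_fderiv_le_of_lipschitz ℝ h
  have h2 := (fderiv ℝ ψ (WithLp.toLp 2 x)).le_of_opNorm_le h1 (EuclideanSpace.single k 1)
  simpa [partials] using h2

lemma hasFDerivAt_toLp {ψ : EuclideanSpace ℝ ι → ℝ} (hψ : ContDiff ℝ 1 ψ) (x : ι → ℝ) :
    HasFDerivAt (fun x => ψ (WithLp.toLp 2 x))
      (∑ k, partials ψ x k • ContinuousLinearMap.proj (R := ℝ) (φ := fun _ : ι => ℝ) k) x := by
  have h1 : HasFDerivAt ψ (fderiv ℝ ψ (WithLp.toLp 2 x)) (WithLp.toLp 2 x) :=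
    (hψ.differentiable one_ne_zero _).hasFDerivAt
  have h2 := h1.comp x ((EuclideanSpace.equiv ι ℝ).symm.hasFDerivAt (x := x))
  convert! h2 using 1
  refine ContinuousLinearMap.ext fun v => ?_
  have hv : (EuclideanSpace.equiv ι ℝ).symm v = ∑ k, v k • EuclideanSpace.single k (1 : ℝ) := by
    ext i
    simp [Finset.sum_apply, Pi.single_apply]
  simp only [ContinuousLinearMap.comp_apply, ContinuousLinearEquiv.coe_coe, hv, map_sum, map_smul]
  simp [partials, mul_comm]

end Gradient

/-! ### Marginals of the standard Gaussian -/

section Marginals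

variable {E : Type*} [NormedAddCommGroup E] [InnerProductSpace ℝ E] [FiniteDimensional ℝ E]
  [MeasurableSpace E] [BorelSpace E] {κ : Type*} [Fintype κ]

/-- The coordinates of a standard Gaussian vector along an orthonormal family are a standard
Gaussian vector. -/
lemma map_stdGaussian_of_orthonormal {v : κ → E} (hv : Orthonormal ℝ v) :
    (stdGaussian E).map (fun G => (WithLp.toLp 2 fun k => inner ℝ (v k) G : EuclideanSpace ℝ κ)) =
      stdGaussian (EuclideanSpace ℝ κ) := by
  have hm : Continuous
      (fun G => (WithLp.toLp 2 fun k => inner ℝ (v k) G : EuclideanSpace ℝ κ)) := by fun_prop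
  have := Measure.isProbabilityMeasure_map (μ := stdGaussian E) hm.aemeasurable
  apply Measure.ext_of_charFun
  ext t
  rw [charFun_apply, integral_map hm.aemeasurable (by fun_prop)]
  have : ∀ G : E, inner ℝ (WithLp.toLp 2 fun k => inner ℝ (v k) G : EuclideanSpace ℝ κ) t =
      inner ℝ G (∑ k, t k • v k) := by
    intro G
    rw [inner_sum, PiLp.inner_apply]
    refine Finset.sum_congr rfl fun k _ => ?_
    simp [real_inner_smul_right, real_inner_comm]
  simp_rw [this]
  rw [← charFun_apply, charFun_stdGaussian, charFun_stdGaussian]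
  have h : ‖∑ k, t k • v k‖ ^ 2 = ‖t‖ ^ 2 := by
    rw [← real_inner_self_eq_norm_sq, hv.inner_sum, EuclideanSpace.real_norm_sq_eq]
    simp [sq]
  rw [← Complex.ofReal_pow, ← Complex.ofReal_pow, h]

lemma indepFun_inner_stdGaussian {κ' : Type*} [Fintype κ'] {v : κ → E} {v' : κ' → E}
    (h : ∀ k k', inner ℝ (v k) (v' k') = 0) :
    IndepFun (fun G k => inner ℝ (v k) G) (fun G k => inner ℝ (v' k) G) (stdGaussian E) := by
  refine HasGaussianLaw.indepFun_of_covariance_eval ?_ fun i j => ?_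
  · let L : E →L[ℝ] (κ → ℝ) × (κ' → ℝ) :=
      (ContinuousLinearMap.pi fun k => innerSL ℝ (v k)).prod
        (ContinuousLinearMap.pi fun k => innerSL ℝ (v' k))
    exact (IsGaussian.hasGaussianLaw_id (μ := stdGaussian E)).map L
  · rw [← covarianceBilin_apply_eq_cov IsGaussian.memLp_two_id, covarianceBilin_stdGaussian]
    exact h i j

end Marginals

/-! ### Poincaré inequality, concentration, and the mean norm -/

section Poincare

variable {ι : Type*} [Fintype ι] [DecidableEq ι]

/-- Interpolation between two equal blocks and two independent ones: the product has expectation `E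
F²` at one end and `(E F)²` at the other. Each of the two ordered pairs of blocks contributes at
least `-1`, so `C = 2` and the loss is 1. A third copy of the space keeps the two families mutually
orthogonal. -/
lemma integral_sq_le_of_contDiff {F : EuclideanSpace ℝ ι → ℝ} (hF : ContDiff ℝ 1 F)
    (hL : LipschitzWith 1 F) {B : ℝ} (hB : ∀ x, |F x| ≤ B) :
    ∫ x, F x ^ 2 ∂(stdGaussian (EuclideanSpace ℝ ι)) ≤
      (∫ x, F x ∂(stdGaussian (EuclideanSpace ℝ ι))) ^ 2 + 1 := by
  let E := EuclideanSpace ℝ (Fin 3 × ι)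
  let v : Fin 3 → ι → E := fun c k => EuclideanSpace.single (c, k) 1
  have hv : ∀ c d k k', inner ℝ (v c k) (v d k') = if c = d ∧ k = k' then 1 else 0 := by
    intro c d k k'
    refine (EuclideanSpace.inner_single_left _ _ _).trans ?_
    simp [v, Prod.ext_iff]
  have horth : ∀ c, Orthonormal ℝ (v c) := by
    intro c
    rw [orthonormal_iff_ite]
    intro k k'
    simp [hv]
  let X : Fin 3 → E → EuclideanSpace ℝ ι := fun c G => WithLp.toLp 2 fun k => inner ℝ (v c k) G
  have hX : ∀ c, Continuous (X c) := fun c => by fun_prop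
  have hlaw : ∀ c (f : EuclideanSpace ℝ ι → ℝ), Continuous f →
      ∫ G, f (X c G) ∂(stdGaussian E) = ∫ x, f x ∂(stdGaussian (EuclideanSpace ℝ ι)) := by
    intro c f hf
    rw [← map_stdGaussian_of_orthonormal (horth c), integral_map (hX c).aemeasurable
      hf.aestronglyMeasurable]
  have hcomp := integral_prod_le_integral_prod (J := Bool) (K := ι) (E := E)
    (φ := fun _ x => F (WithLp.toLp 2 x)) (φ' := fun _ => partials F) (B := max B 1)
    (fun _ => hasFDerivAt_toLp hF) (fun _ => continuous_partials hF)
    (fun _ x => (hB _).trans (le_max_left _ _))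
    (fun _ x k => (abs_partials_le hL x k).trans (le_max_right _ _))
    (p := fun _ => v 0) (q := fun b => v (if b then 1 else 2)) ?_ ?_ (C := 2) ?_
  · have hind : IndepFun (fun G => F (X 1 G)) (fun G => F (X 2 G)) (stdGaussian E) := by
      have h := indepFun_inner_stdGaussian (E := E) (v := v 1) (v' := v 2)
        (fun k k' => by simp [hv])
      have hm : Measurable fun x : ι → ℝ => F (WithLp.toLp 2 x) :=
        (hF.continuous.comp (PiLp.continuous_toLp 2 _)).measurable
      exact h.comp hm hm
    have hprod := hind.integral_fun_mul_eq_mul_integral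
      (hF.continuous.comp (hX 1)).aestronglyMeasurable
      (hF.continuous.comp (hX 2)).aestronglyMeasurable
    have e0 := hlaw 0 (fun x => F x ^ 2) (hF.continuous.pow 2)
    rw [hlaw 1 F hF.continuous, hlaw 2 F hF.continuous] at hprod
    simp only [Fintype.prod_bool] at hcomp
    have e1 : ∫ G : E, F (WithLp.toLp 2 (coords (fun _ : Bool => v 0) true G)) *
        F (WithLp.toLp 2 (coords (fun _ : Bool => v 0) false G)) ∂(stdGaussian E) =
        ∫ G, F (X 0 G) ^ 2 ∂(stdGaussian E) :=
      integral_congr_ae (ae_of_all _ fun G => (sq (F (X 0 G))).symm)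
    rw [e1, e0] at hcomp
    have e2 : ∫ G : E, F (WithLp.toLp 2
          (coords (fun b : Bool => v (if b then 1 else 2)) true G)) *
        F (WithLp.toLp 2 (coords (fun b : Bool => v (if b then 1 else 2)) false G))
          ∂(stdGaussian E) = ∫ G, F (X 1 G) * F (X 2 G) ∂(stdGaussian E) := rfl
    rw [e2, hprod] at hcomp
    linarith
  · intro j k l k'
    rw [hv, if_neg]
    cases l <;> simp
  · intro j k k'
    simp [hv]
  · intro x
    have h1 := (abs_le.1 (abs_sum_partials_mul_le hL hL (x true) (x false))).2
    have h2 : ∑ k, partials F (x false) k * partials F (x true) k =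
        ∑ k, partials F (x true) k * partials F (x false) k :=
      Finset.sum_congr rfl fun _ _ => mul_comm _ _
    have e1 : (Finset.univ : Finset Bool).erase true = {false} := by decide
    have e2 : (Finset.univ : Finset Bool).erase false = {true} := by decide
    simp only [Fintype.sum_bool, e1, e2, Finset.sum_singleton, hv, Finset.erase_singleton,
      Finset.prod_empty, one_mul]
    simp [h2]
    linarith

omit [DecidableEq ι] in
lemma abs_le_of_lipschitz {F : EuclideanSpace ℝ ι → ℝ} (hL : LipschitzWith 1 F)
    (x : EuclideanSpace ℝ ι) : |F x| ≤ |F 0| + ‖x‖ := by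
  have h := hL.dist_le_mul x 0
  rw [Real.dist_eq, dist_zero_right, NNReal.coe_one, one_mul] at h
  have := abs_sub_abs_le_abs_sub (F x) (F 0)
  linarith

omit [DecidableEq ι] in
lemma memLp_two_of_lipschitz {F : EuclideanSpace ℝ ι → ℝ} (hL : LipschitzWith 1 F) :
    MemLp F 2 (stdGaussian (EuclideanSpace ℝ ι)) := by
  have h1 := (IsGaussian.memLp_two_id (μ := stdGaussian (EuclideanSpace ℝ ι))).norm
  have h2 : MemLp (fun _ : EuclideanSpace ℝ ι => |F 0|) 2 (stdGaussian (EuclideanSpace ℝ ι)) :=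
    memLp_const _
  refine (h2.add h1).mono hL.continuous.aestronglyMeasurable (ae_of_all _ fun x => ?_)
  exact (abs_le_of_lipschitz hL x).trans (le_abs_self _)

omit [DecidableEq ι] in
lemma integrable_of_lipschitz {F : EuclideanSpace ℝ ι → ℝ} (hL : LipschitzWith 1 F) :
    Integrable F (stdGaussian (EuclideanSpace ℝ ι)) :=
  (memLp_two_of_lipschitz hL).integrable one_le_two

/-- The Gaussian Poincaré inequality for Lipschitz functions. -/
theorem integral_sq_le_of_lipschitz {F : EuclideanSpace ℝ ι → ℝ} (hL : LipschitzWith 1 F) :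
    ∫ x, F x ^ 2 ∂(stdGaussian (EuclideanSpace ℝ ι)) ≤
      (∫ x, F x ∂(stdGaussian (EuclideanSpace ℝ ι))) ^ 2 + 1 := by
  -- Truncation supplies boundedness and mollification supplies smoothness, both preserving the
  -- Lipschitz constant; the limit is by domination with `|F| + 1`.
  have hclamp : ∀ n : ℕ, LipschitzWith 1 fun x => max (-(n : ℝ)) (min (F x) n) := fun n =>
    (hL.min_const (n : ℝ)).const_max (-(n : ℝ))
  choose H hH1 hH2 hH3 using fun n : ℕ =>
    exists_contDiff_lipschitz_approx (hclamp n) (Nat.one_div_pos_of_nat (α := ℝ) (n := n))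
  have hδ : ∀ n : ℕ, (1 : ℝ) / (n + 1) ≤ 1 := fun n =>
    (div_le_one (by positivity)).2 (by linarith [n.cast_nonneg (α := ℝ)])
  have hcl : ∀ (n : ℕ) (x), |max (-(n : ℝ)) (min (F x) n)| ≤ |F x| := by
    intro n x
    have hn := n.cast_nonneg (α := ℝ)
    rw [abs_le]
    constructor
    · refine le_max_of_le_right (le_min (neg_abs_le _) ?_)
      linarith [abs_nonneg (F x)]
    · refine max_le (by linarith [abs_nonneg (F x)]) (min_le_of_left_le (le_abs_self _))
  have hbd : ∀ n x, |H n x| ≤ |F x| + 1 := by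
    intro n x
    have h1 := abs_sub_abs_le_abs_sub (H n x) (max (-(n : ℝ)) (min (F x) n))
    linarith [hH3 n x, hδ n, hcl n x]
  have hbn : ∀ (n : ℕ) x, |H n x| ≤ n + 1 := by
    intro n x
    have h1 := abs_sub_abs_le_abs_sub (H n x) (max (-(n : ℝ)) (min (F x) n))
    have h2 : |max (-(n : ℝ)) (min (F x) n)| ≤ n :=
      abs_le.2 ⟨le_max_left _ _, max_le (by linarith [n.cast_nonneg (α := ℝ)]) (min_le_right _ _)⟩
    linarith [hH3 n x, hδ n]
  have hlim : ∀ x, Tendsto (fun n => H n x) atTop (𝓝 (F x)) := by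
    intro x
    have h0 : Tendsto (fun n : ℕ => (1 : ℝ) / (n + 1)) atTop (𝓝 0) :=
      tendsto_one_div_add_atTop_nhds_zero_nat
    refine tendsto_iff_dist_tendsto_zero.2 (squeeze_zero' (Eventually.of_forall fun _ =>
      dist_nonneg) ?_ h0)
    obtain ⟨N, hN⟩ := exists_nat_ge |F x|
    filter_upwards [eventually_ge_atTop N] with n hn
    have hn' : |F x| ≤ n := hN.trans (by exact_mod_cast hn)
    have he : max (-(n : ℝ)) (min (F x) n) = F x := by
      rw [min_eq_left ((le_abs_self _).trans hn'), max_eq_right (abs_le.1 hn').1]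
    have := hH3 n x
    rwa [he] at this
  have hFm := memLp_two_of_lipschitz hL
  have hFi := integrable_of_lipschitz hL
  have hdom1 : Integrable (fun x => |F x| + 1) (stdGaussian (EuclideanSpace ℝ ι)) :=
    hFi.abs.add (integrable_const _)
  have hdom2 : Integrable (fun x => (|F x| + 1) ^ 2) (stdGaussian (EuclideanSpace ℝ ι)) :=
    (hFm.abs.add (memLp_const 1)).integrable_sq
  have t1 : Tendsto (fun n => ∫ x, H n x ∂(stdGaussian (EuclideanSpace ℝ ι))) atTop
      (𝓝 (∫ x, F x ∂(stdGaussian (EuclideanSpace ℝ ι)))) :=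
    tendsto_integral_of_dominated_convergence _
      (fun n => (hH2 n).continuous.aestronglyMeasurable) hdom1
      (fun n => ae_of_all _ (hbd n)) (ae_of_all _ hlim)
  have t2 : Tendsto (fun n => ∫ x, H n x ^ 2 ∂(stdGaussian (EuclideanSpace ℝ ι))) atTop
      (𝓝 (∫ x, F x ^ 2 ∂(stdGaussian (EuclideanSpace ℝ ι)))) := by
    refine tendsto_integral_of_dominated_convergence _
      (fun n => ((hH2 n).continuous.pow 2).aestronglyMeasurable) hdom2
      (fun n => ae_of_all _ fun x => ?_) (ae_of_all _ fun x => (hlim x).pow 2)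
    rw [Real.norm_eq_abs, abs_pow]
    exact pow_le_pow_left₀ (abs_nonneg _) (hbd n x) 2
  exact le_of_tendsto_of_tendsto' t2 ((t1.pow 2).add_const 1) fun n =>
    integral_sq_le_of_contDiff (hH1 n) (hH2 n) (hbn n)

/-- Concentration of a Lipschitz function of a standard Gaussian vector around its mean. -/
theorem measure_abs_sub_integral_ge_le {F : EuclideanSpace ℝ ι → ℝ} (hL : LipschitzWith 1 F)
    {t : ℝ} (ht : 0 < t) :
    (stdGaussian (EuclideanSpace ℝ ι)).real
      {x | t ≤ |F x - ∫ y, F y ∂(stdGaussian (EuclideanSpace ℝ ι))|} ≤ 1 / t ^ 2 := by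
  have hm := memLp_two_of_lipschitz hL
  have h := meas_ge_le_variance_div_sq hm ht
  have hv : Var[F; stdGaussian (EuclideanSpace ℝ ι)] ≤ 1 := by
    rw [variance_eq_sub hm]
    have := integral_sq_le_of_lipschitz hL
    simp only [Pi.pow_apply]
    linarith
  refine (ENNReal.toReal_mono ENNReal.ofReal_ne_top h).trans ?_
  rw [ENNReal.toReal_ofReal (div_nonneg (variance_nonneg _ _) (sq_nonneg t))]
  gcongr

lemma integral_norm_sq_stdGaussian :
    ∫ x, ‖x‖ ^ 2 ∂(stdGaussian (EuclideanSpace ℝ ι)) = Fintype.card ι := by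
  simp_rw [EuclideanSpace.real_norm_sq_eq]
  have h : ∀ i, Integrable (fun x : EuclideanSpace ℝ ι => x i ^ 2)
      (stdGaussian (EuclideanSpace ℝ ι)) := fun i =>
    ((EuclideanSpace.proj (𝕜 := ℝ) i).comp_memLp' IsGaussian.memLp_two_id).integrable_sq
  rw [integral_finsetSum _ fun i _ => h i]
  have h1 : ∀ i, ∫ x : EuclideanSpace ℝ ι, x i ^ 2 ∂(stdGaussian (EuclideanSpace ℝ ι)) = 1 := by
    intro i
    have h2 := variance_dual_stdGaussian 
      (EuclideanSpace.proj (𝕜 := ℝ) i : StrongDual ℝ (EuclideanSpace ℝ ι))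
    rw [variance_of_integral_eq_zero (by fun_prop) (integral_strongDual_stdGaussian _)] at h2
    have h3 : ‖(EuclideanSpace.proj (𝕜 := ℝ) i : StrongDual ℝ (EuclideanSpace ℝ ι))‖ ^ 2 = 1 := by
      rw [(EuclideanSpace.basisFun ι ℝ).norm_dual]
      simp
    rw [h3] at h2
    simpa using h2
  simp [h1]

/-- The second moment of the norm is the dimension and its variance lies between 0 and 1, the upper
bound by Poincaré. -/
lemma integral_norm_stdGaussian_bounds :
    √(Fintype.card ι) - 1 ≤ ∫ x, ‖x‖ ∂(stdGaussian (EuclideanSpace ℝ ι)) ∧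
      ∫ x, ‖x‖ ∂(stdGaussian (EuclideanSpace ℝ ι)) ≤ √(Fintype.card ι) := by
  have hL : LipschitzWith 1 (fun x : EuclideanSpace ℝ ι => ‖x‖) := lipschitzWith_one_norm
  have h1 := integral_sq_le_of_lipschitz hL
  rw [integral_norm_sq_stdGaussian] at h1
  have hm := memLp_two_of_lipschitz hL
  have h2 := variance_nonneg (fun x : EuclideanSpace ℝ ι => ‖x‖) (stdGaussian (EuclideanSpace ℝ ι))
  rw [variance_eq_sub hm] at h2
  simp only [Pi.pow_apply, integral_norm_sq_stdGaussian] at h2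
  have h0 : 0 ≤ ∫ x, ‖x‖ ∂(stdGaussian (EuclideanSpace ℝ ι)) :=
    integral_nonneg fun x => norm_nonneg _
  constructor
  · rw [sub_le_iff_le_add, Real.sqrt_le_left (by linarith)]
    nlinarith
  · exact Real.le_sqrt_of_sq_le (by linarith)

end Poincare

/-! ### Bounded derivative of the smooth step -/

section SmoothStep

lemma exists_abs_deriv_smoothTransition_le :
    ∃ B : ℝ, ∀ t, |deriv Real.smoothTransition t| ≤ B := by
  have hc : Continuous (deriv Real.smoothTransition) :=
    (Real.smoothTransition.contDiff (n := 1)).continuous_deriv_one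
  obtain ⟨B, hB⟩ := isCompact_Icc.exists_bound_of_continuousOn (s := Set.Icc (0 : ℝ) 1)
    hc.continuousOn
  refine ⟨B, fun t => ?_⟩
  have hB0 : 0 ≤ B := (norm_nonneg _).trans (hB 0 (by simp))
  rcases lt_or_ge t 0 with h | h
  · have : Real.smoothTransition =ᶠ[𝓝 t] fun _ => 0 := by
      filter_upwards [Iio_mem_nhds h] with s hs
      exact Real.smoothTransition.zero_of_nonpos (le_of_lt hs)
    rw [this.deriv_eq]; simpa using hB0
  rcases lt_or_ge 1 t with h' | h'
  · have : Real.smoothTransition =ᶠ[𝓝 t] fun _ => 1 := by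
      filter_upwards [Ioi_mem_nhds h'] with s hs
      exact Real.smoothTransition.one_of_one_le (le_of_lt hs)
    rw [this.deriv_eq]; simpa using hB0
  · exact hB t ⟨h, h'⟩

end SmoothStep

/-! ### Gordon's comparison for Lipschitz thresholds -/

section Comparison

variable {ι κ : Type*} [Fintype ι] [Fintype κ] [DecidableEq ι] [DecidableEq κ]

/-- The index set of the entries of a matrix, a scalar, and two vectors. -/
abbrev GordonIndex (ι κ : Type*) := (ι × κ) ⊕ (Unit ⊕ (κ ⊕ ι))

/-- The product of the matrix part of `G` with the vector `w`. -/
noncomputable def matApply (G : EuclideanSpace ℝ (GordonIndex ι κ)) (w : EuclideanSpace ℝ κ) :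
    EuclideanSpace ℝ ι :=
  WithLp.toLp 2 fun a => ∑ b, w b * G (Sum.inl (a, b))

/-- The scalar part of `G`. -/
def scalarPart (G : EuclideanSpace ℝ (GordonIndex ι κ)) : ℝ := G (Sum.inr (Sum.inl ()))

/-- The first vector part of `G`. -/
noncomputable def vecPart (G : EuclideanSpace ℝ (GordonIndex ι κ)) : EuclideanSpace ℝ κ :=
  WithLp.toLp 2 fun b => G (Sum.inr (Sum.inr (Sum.inl b)))

/-- The second vector part of `G`. -/
noncomputable def vecPart' (G : EuclideanSpace ℝ (GordonIndex ι κ)) : EuclideanSpace ℝ ι :=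
  WithLp.toLp 2 fun a => G (Sum.inr (Sum.inr (Sum.inr a)))

/-- The coordinate vectors of the bilinear process `(A w, z)`. -/
noncomputable def bilinVec (w : EuclideanSpace ℝ κ) : Option ι →
    EuclideanSpace ℝ (GordonIndex ι κ)
  | some a => ∑ b, w b • EuclideanSpace.single (Sum.inl (a, b)) 1
  | none => EuclideanSpace.single (Sum.inr (Sum.inl ())) 1

/-- The coordinate vectors of the decoupled process `(h, ⟪g, w⟫)`. -/
noncomputable def decoupVec (w : EuclideanSpace ℝ κ) : Option ι →
    EuclideanSpace ℝ (GordonIndex ι κ)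
  | some a => EuclideanSpace.single (Sum.inr (Sum.inr (Sum.inr a))) 1
  | none => ∑ b, w b • EuclideanSpace.single (Sum.inr (Sum.inr (Sum.inl b))) 1

lemma inner_decoupVec_bilinVec (w w' : EuclideanSpace ℝ κ) (k k' : Option ι) :
    inner ℝ (decoupVec w k) (bilinVec w' k') = 0 := by
  cases k <;> cases k' <;>
    simp [decoupVec, bilinVec, sum_inner, inner_sum, real_inner_smul_left, real_inner_smul_right,
      EuclideanSpace.inner_single_left]

/-- Against `inner_decoupVec`, the values `1` and `⟪w, w'⟫` are interchanged. Hence the covariances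
agree for `w = w'` of norm one, and otherwise differ by `±(1 - ⟪w, w'⟫)` on the diagonal. -/
lemma inner_bilinVec (w w' : EuclideanSpace ℝ κ) (k k' : Option ι) :
    inner ℝ (bilinVec w k) (bilinVec w' k') =
      if k = k' then (if k = none then 1 else inner ℝ w w') else 0 := by
  cases k <;> cases k' <;>
    simp [bilinVec, sum_inner, inner_sum, PiLp.inner_apply, ite_and]

lemma inner_decoupVec (w w' : EuclideanSpace ℝ κ) (k k' : Option ι) :
    inner ℝ (decoupVec w k) (decoupVec w' k') =
      if k = k' then (if k = none then inner ℝ w w' else 1) else 0 := by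
  cases k <;> cases k' <;>
    simp [decoupVec, sum_inner, inner_sum, PiLp.inner_apply, mul_comm, eq_comm]

lemma inner_bilinVec_some (w : EuclideanSpace ℝ κ) (G : EuclideanSpace ℝ (GordonIndex ι κ))
    (a : ι) : inner ℝ (bilinVec w (some a)) G = matApply G w a := by
  simp [bilinVec, matApply, sum_inner, real_inner_smul_left, EuclideanSpace.inner_single_left]

lemma inner_bilinVec_none (w : EuclideanSpace ℝ κ) (G : EuclideanSpace ℝ (GordonIndex ι κ)) :
    inner ℝ (bilinVec w none) G = scalarPart G := by
  simp [bilinVec, scalarPart, EuclideanSpace.inner_single_left]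

lemma inner_decoupVec_some (w : EuclideanSpace ℝ κ) (G : EuclideanSpace ℝ (GordonIndex ι κ))
    (a : ι) : inner ℝ (decoupVec w (some a)) G = vecPart' G a := by
  simp [decoupVec, vecPart', EuclideanSpace.inner_single_left]

lemma inner_decoupVec_none (w : EuclideanSpace ℝ κ) (G : EuclideanSpace ℝ (GordonIndex ι κ)) :
    inner ℝ (decoupVec w none) G = inner ℝ w (vecPart G) := by
  simp [decoupVec, vecPart, sum_inner, PiLp.inner_apply, mul_comm]

omit [DecidableEq ι] [DecidableEq κ] [Fintype ι] in
lemma continuous_matApply (w : EuclideanSpace ℝ κ) :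
    Continuous fun G : EuclideanSpace ℝ (GordonIndex ι κ) => matApply G w := by
  unfold matApply
  fun_prop

omit [DecidableEq ι] [DecidableEq κ] [Fintype ι] [Fintype κ] in
lemma continuous_scalarPart :
    Continuous (scalarPart : EuclideanSpace ℝ (GordonIndex ι κ) → ℝ) := by
  unfold scalarPart
  fun_prop

omit [DecidableEq ι] [DecidableEq κ] [Fintype ι] [Fintype κ] in
lemma continuous_vecPart :
    Continuous (vecPart : EuclideanSpace ℝ (GordonIndex ι κ) → EuclideanSpace ℝ κ) := by
  unfold vecPart
  fun_prop

omit [DecidableEq ι] [DecidableEq κ] [Fintype ι] [Fintype κ] in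
lemma continuous_vecPart' :
    Continuous (vecPart' : EuclideanSpace ℝ (GordonIndex ι κ) → EuclideanSpace ℝ ι) := by
  unfold vecPart'
  fun_prop

omit [Fintype κ] [DecidableEq κ] [DecidableEq ι] [Fintype ι] in
lemma deriv_smoothTransition_nonneg (t : ℝ) : 0 ≤ deriv Real.smoothTransition t :=
  Real.smoothTransition.monotone.deriv_nonneg

/-- The partial derivatives of `x ↦ s (x none - ψ (x ∘ some))`, `s` the smooth step. -/
noncomputable def stepPartials (ψ : EuclideanSpace ℝ ι → ℝ) (x : Option ι → ℝ) :
    Option ι → ℝ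
  | none => deriv Real.smoothTransition (x none - ψ (WithLp.toLp 2 fun a => x (some a)) + 2)
  | some a => -deriv Real.smoothTransition (x none - ψ (WithLp.toLp 2 fun a => x (some a)) + 2) *
      partials ψ (fun a => x (some a)) a

lemma hasFDerivAt_step {ψ : EuclideanSpace ℝ ι → ℝ} (hψ : ContDiff ℝ 1 ψ) (x : Option ι → ℝ) :
    HasFDerivAt (fun x : Option ι → ℝ =>
        Real.smoothTransition (x none - ψ (WithLp.toLp 2 fun a => x (some a)) + 2))
      (∑ k, stepPartials ψ x k •
        ContinuousLinearMap.proj (R := ℝ) (φ := fun _ : Option ι => ℝ) k) x := by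
  let R : (Option ι → ℝ) →L[ℝ] (ι → ℝ) :=
    ContinuousLinearMap.pi fun a => ContinuousLinearMap.proj (some a)
  have h1 := (hasFDerivAt_toLp hψ (R x)).comp x R.hasFDerivAt
  have h2 : HasFDerivAt (fun x : Option ι → ℝ => x none)
      (ContinuousLinearMap.proj (R := ℝ) (φ := fun _ : Option ι => ℝ) none) x :=
    (ContinuousLinearMap.proj (R := ℝ) (φ := fun _ : Option ι => ℝ) none).hasFDerivAt
  have h3 : HasDerivAt Real.smoothTransition (deriv Real.smoothTransition
      (x none - ψ (WithLp.toLp 2 fun a => x (some a)) + 2))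
      (x none - ψ (WithLp.toLp 2 fun a => x (some a)) + 2) :=
    ((Real.smoothTransition.contDiff (n := 1)).differentiable one_ne_zero _).hasDerivAt
  have h4 := h3.comp_hasFDerivAt x ((h2.sub h1).add_const 2)
  convert! h4 using 1
  refine ContinuousLinearMap.ext fun v => ?_
  simp [stepPartials, Fintype.sum_option, R, Finset.mul_sum, mul_assoc,
    sub_eq_add_neg]

lemma continuous_stepPartials {ψ : EuclideanSpace ℝ ι → ℝ} (hψ : ContDiff ℝ 1 ψ)
    (k : Option ι) : Continuous fun x => stepPartials ψ x k := by
  have hd : Continuous (deriv Real.smoothTransition) :=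
    (Real.smoothTransition.contDiff (n := 1)).continuous_deriv_one
  have hψc := hψ.continuous
  have h1 : Continuous fun x : Option ι → ℝ => deriv Real.smoothTransition
      (x none - ψ (WithLp.toLp 2 fun a => x (some a)) + 2) :=
    hd.comp (((continuous_apply none).sub (hψc.comp (by fun_prop))).add continuous_const)
  cases k with
  | none => exact h1
  | some a =>
    have h2 : Continuous fun x : Option ι → ℝ => partials ψ (fun a => x (some a)) a :=
      (continuous_partials hψ a).comp (by fun_prop)
    exact h1.neg.mul h2

lemma abs_stepPartials_le {B : ℝ} (hB : ∀ t, |deriv Real.smoothTransition t| ≤ B)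
    {ψ : EuclideanSpace ℝ ι → ℝ} (hψ : LipschitzWith 1 ψ) (x : Option ι → ℝ) (k : Option ι) :
    |stepPartials ψ x k| ≤ B := by
  cases k with
  | none => exact hB _
  | some a =>
    rw [stepPartials, abs_mul, abs_neg]
    exact (mul_le_of_le_one_right (abs_nonneg _) (abs_partials_le hψ _ a)).trans (hB _)

/-- Bilinear coupling increases the covariances in the directions along which products of
smooth steps grow. -/
lemma sum_cov_stepPartials_nonneg {w w' : EuclideanSpace ℝ κ} (hw : ‖w‖ = 1) (hw' : ‖w'‖ = 1)
    {ψ ψ' : EuclideanSpace ℝ ι → ℝ} (hψ : LipschitzWith 1 ψ) (hψ' : LipschitzWith 1 ψ')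
    (x x' : Option ι → ℝ) :
    0 ≤ ∑ k, ∑ k', (inner ℝ (bilinVec w' k') (bilinVec w k) -
      inner ℝ (decoupVec w' k') (decoupVec w k)) * (stepPartials ψ x k * stepPartials ψ' x' k') := by
  have hρ : inner ℝ w' w ≤ (1 : ℝ) := by
    simpa [hw, hw'] using real_inner_le_norm w' w
  have hcs := (abs_le.1 (abs_sum_partials_mul_le hψ hψ' (fun a => x (some a))
    (fun a => x' (some a)))).2
  have hc := deriv_smoothTransition_nonneg
    (x none - ψ (WithLp.toLp 2 fun a => x (some a)) + 2)
  have hd := deriv_smoothTransition_nonneg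
    (x' none - ψ' (WithLp.toLp 2 fun a => x' (some a)) + 2)
  set c := deriv Real.smoothTransition
    (x none - ψ (WithLp.toLp 2 fun a => x (some a)) + 2) with hc'
  set d := deriv Real.smoothTransition
    (x' none - ψ' (WithLp.toLp 2 fun a => x' (some a)) + 2) with hd'
  -- The double sum factors into `1 - ⟪w', w⟫`, the two step derivatives, and one minus the inner
  -- product of the gradients, all nonnegative.
  have hval : ∑ k, ∑ k', (inner ℝ (bilinVec w' k') (bilinVec w k) -
      inner ℝ (decoupVec w' k') (decoupVec w k)) *
        (stepPartials ψ x k * stepPartials ψ' x' k') =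
      (1 - inner ℝ w' w) * (c * d) *
        (1 - ∑ a, partials ψ (fun a => x (some a)) a *
          partials ψ' (fun a => x' (some a)) a) := by
    simp only [inner_bilinVec, inner_decoupVec, Fintype.sum_option, stepPartials, ← hc', ← hd']
    simp only [reduceCtorEq, if_true, if_false, sub_zero, zero_mul, Finset.sum_const_zero,
      add_zero, zero_add, Option.some.injEq]
    rw [mul_sub, mul_one, Finset.mul_sum, sub_eq_add_neg (_ * (c * d)),
      ← Finset.sum_neg_distrib]
    congr 1
    refine Finset.sum_congr rfl fun a _ => ?_
    rw [Finset.sum_eq_single a]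
    · simp only [if_true]
      ring
    · intro b _ hb
      simp [hb]
    · simp
  rw [hval]
  exact mul_nonneg (mul_nonneg (by linarith) (mul_nonneg hc hd)) (by linarith)

/-- Gordon's comparison inequality for finitely many unit vectors. -/
theorem measure_decoupled_le_measure_bilinear {J : Type*} [Fintype J] [DecidableEq J]
    {w : J → EuclideanSpace ℝ κ} (hw : ∀ j, ‖w j‖ = 1) {ψ : J → EuclideanSpace ℝ ι → ℝ}
    (hψ : ∀ j, LipschitzWith 1 (ψ j)) :
    (stdGaussian (EuclideanSpace ℝ (GordonIndex ι κ))).real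
        {G | ∀ j, ψ j (vecPart' G) ≤ inner ℝ (w j) (vecPart G)} ≤
      (stdGaussian (EuclideanSpace ℝ (GordonIndex ι κ))).real
        {G | ∀ j, ψ j (matApply G (w j)) - 3 ≤ scalarPart G} := by
  obtain ⟨B, hB⟩ := exists_abs_deriv_smoothTransition_le
  choose θ hθ1 hθ2 hθ3 using fun j => exists_contDiff_lipschitz_approx (hψ j) one_pos
  -- The shift 2 absorbs the mollification error 1: the factor equals 1 once `ψ j ≤ x none`, and
  -- vanishes once `x none < ψ j - 3`. The products thus lie between the indicators of the two
  -- events.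
  set φ : J → (Option ι → ℝ) → ℝ := fun j x =>
    Real.smoothTransition (x none - θ j (WithLp.toLp 2 fun a => x (some a)) + 2) with hφ
  have hφ0 : ∀ j x, 0 ≤ φ j x := fun j x => Real.smoothTransition.nonneg _
  have hφ1 : ∀ j x, φ j x ≤ 1 := fun j x => Real.smoothTransition.le_one _
  have hcomp := integral_prod_le_integral_prod (φ := φ) (φ' := fun j => stepPartials (θ j))
    (fun j => hasFDerivAt_step (hθ1 j)) (fun j => continuous_stepPartials (hθ1 j))
    (B := max B 1)
    (fun j x => (abs_le.2 ⟨by linarith [hφ0 j x], hφ1 j x⟩).trans (le_max_right _ _))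
    (fun j x k => (abs_stepPartials_le hB (hθ2 j) x k).trans (le_max_left _ _))
    (p := fun j => decoupVec (w j)) (q := fun j => bilinVec (w j))
    (fun j k l k' => inner_decoupVec_bilinVec _ _ _ _) ?_ (C := 0) ?_
  · have hφc : ∀ j, Continuous (φ j) := fun j =>
      continuous_iff_continuousAt.2 fun x => (hasFDerivAt_step (hθ1 j) x).continuousAt
    have hprod1 : ∀ x : J → Option ι → ℝ, |∏ j, φ j (x j)| ≤ 1 := fun x => by
      rw [abs_of_nonneg (Finset.prod_nonneg fun j _ => hφ0 j _)]
      exact Finset.prod_le_one (fun j _ => hφ0 j _) fun j _ => hφ1 j _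
    have hint : ∀ v : J → Option ι → EuclideanSpace ℝ (GordonIndex ι κ),
        Integrable (fun G => ∏ j, φ j (coords v j G))
          (stdGaussian (EuclideanSpace ℝ (GordonIndex ι κ))) := fun v =>
      Integrable.of_bound (continuous_prod_coords hφc _ v).aestronglyMeasurable 1
        (ae_of_all _ fun G => hprod1 fun j => coords v j G)
    have hq : ∀ j G, φ j (coords (fun j => bilinVec (w j)) j G) =
        Real.smoothTransition (scalarPart G - θ j (matApply G (w j)) + 2) := by
      intro j G
      simp only [hφ, coords, inner_bilinVec_none, inner_bilinVec_some]
    have hp : ∀ j G, φ j (coords (fun j => decoupVec (w j)) j G) =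
        Real.smoothTransition (inner ℝ (w j) (vecPart G) - θ j (vecPart' G) + 2) := by
      intro j G
      simp only [hφ, coords, inner_decoupVec_none, inner_decoupVec_some]
    have hm1 : MeasurableSet {G : EuclideanSpace ℝ (GordonIndex ι κ) |
        ∀ j, ψ j (vecPart' G) ≤ inner ℝ (w j) (vecPart G)} := by
      rw [Set.ofPred_forall]
      exact MeasurableSet.iInter fun j => (isClosed_le ((hψ j).continuous.comp continuous_vecPart')
        (continuous_const.inner continuous_vecPart)).measurableSet
    have hm2 : MeasurableSet {G : EuclideanSpace ℝ (GordonIndex ι κ) |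
        ∀ j, ψ j (matApply G (w j)) - 3 ≤ scalarPart G} := by
      rw [Set.ofPred_forall]
      exact MeasurableSet.iInter fun j => (isClosed_le (((hψ j).continuous.comp
        (continuous_matApply (w j))).sub continuous_const) continuous_scalarPart).measurableSet
    rw [zero_div, sub_zero] at hcomp
    rw [← integral_indicator_one hm1, ← integral_indicator_one hm2]
    refine le_trans ?_ (le_trans hcomp ?_)
    · refine integral_mono ((integrable_const 1).indicator hm1) (hint _) fun G => ?_
      by_cases hG : G ∈ {G : EuclideanSpace ℝ (GordonIndex ι κ) |
          ∀ j, ψ j (vecPart' G) ≤ inner ℝ (w j) (vecPart G)}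
      · refine (Set.indicator_le_self' (fun _ _ => zero_le_one) G).trans ?_
        refine (Finset.prod_eq_one fun j _ => ?_).ge
        rw [hp]
        refine Real.smoothTransition.one_of_one_le ?_
        have h1 := hG j
        have h2 := (abs_le.1 (hθ3 j (vecPart' G))).2
        linarith
      · refine (Set.indicator_of_notMem hG _).trans_le ?_
        exact Finset.prod_nonneg fun j _ => hφ0 j _
    · refine integral_mono (hint _) ((integrable_const 1).indicator hm2) fun G => ?_
      by_cases hG : G ∈ {G : EuclideanSpace ℝ (GordonIndex ι κ) |
          ∀ j, ψ j (matApply G (w j)) - 3 ≤ scalarPart G}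
      · refine le_of_le_of_eq ?_ (Set.indicator_of_mem hG _).symm
        exact Finset.prod_le_one (fun j _ => hφ0 j _) fun j _ => hφ1 j _
      · refine le_of_le_of_eq ?_ (Set.indicator_of_notMem hG _).symm
        rw [Set.mem_ofPred_eq] at hG
        push Not at hG
        obtain ⟨j, hj⟩ := hG
        refine (Finset.prod_eq_zero (Finset.mem_univ j) ?_).le
        rw [hq]
        refine Real.smoothTransition.zero_of_nonpos ?_
        have h2 := (abs_le.1 (hθ3 j (matApply G (w j)))).1
        linarith
  · intro j k k'
    have hww : inner ℝ (w j) (w j) = (1 : ℝ) := by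
      rw [real_inner_self_eq_norm_sq, hw, one_pow]
    simp only [inner_bilinVec, inner_decoupVec, hww, ite_self]
  · intro x
    rw [neg_zero]
    refine Finset.sum_nonneg fun j _ => Finset.sum_nonneg fun l _ =>
      mul_nonneg (Finset.prod_nonneg fun i _ => hφ0 i _) ?_
    exact sum_cov_stepPartials_nonneg (hw j) (hw l) (hθ2 j) (hθ2 l) (x j) (x l)

/-- Gordon's comparison inequality for a sequence of unit vectors. -/
theorem measure_decoupled_le_measure_bilinear_seq
    {w : ℕ → EuclideanSpace ℝ κ} (hw : ∀ j, ‖w j‖ = 1) {ψ : ℕ → EuclideanSpace ℝ ι → ℝ}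
    (hψ : ∀ j, LipschitzWith 1 (ψ j)) :
    (stdGaussian (EuclideanSpace ℝ (GordonIndex ι κ))).real
        {G | ∀ j, ψ j (vecPart' G) ≤ inner ℝ (w j) (vecPart G)} ≤
      (stdGaussian (EuclideanSpace ℝ (GordonIndex ι κ))).real
        {G | ∀ j, ψ j (matApply G (w j)) - 3 ≤ scalarPart G} := by
  set γ := stdGaussian (EuclideanSpace ℝ (GordonIndex ι κ)) with hγ
  set s : ℕ → Set (EuclideanSpace ℝ (GordonIndex ι κ)) := fun N =>
    {G | ∀ j : Fin N, ψ j (matApply G (w j)) - 3 ≤ scalarPart G} with hs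
  have hm : ∀ N, MeasurableSet (s N) := by
    intro N
    simp only [hs, Set.ofPred_forall]
    exact MeasurableSet.iInter fun j => (isClosed_le (((hψ j).continuous.comp
      (continuous_matApply (w j))).sub continuous_const) continuous_scalarPart).measurableSet
  have hanti : Antitone s := fun N M hNM G hG j => hG ⟨j, j.2.trans_le hNM⟩
  have hinter : ⋂ N, s N = {G | ∀ j, ψ j (matApply G (w j)) - 3 ≤ scalarPart G} := by
    ext G
    simp only [Set.mem_iInter, hs, Set.mem_ofPred_eq]
    exact ⟨fun h j => h (j + 1) ⟨j, j.lt_succ_self⟩, fun h N j => h j⟩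
  have hlim := tendsto_measure_iInter_atTop (μ := γ) (fun N => (hm N).nullMeasurableSet) hanti
    ⟨0, measure_ne_top _ _⟩
  rw [hinter] at hlim
  have hlim' := (ENNReal.tendsto_toReal (measure_ne_top γ _)).comp hlim
  refine ge_of_tendsto' hlim' fun N => ?_
  refine le_trans (measureReal_mono fun G hG => ?_)
    (measure_decoupled_le_measure_bilinear (J := Fin N) (fun j => hw j) fun j => hψ j)
  exact fun j => hG j

end Comparison

/-! ### Laws of the parts of the Gaussian vector -/

section Laws

variable {ι κ : Type*} [Fintype ι] [Fintype κ] [DecidableEq ι] [DecidableEq κ]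

lemma map_vecPart :
    (stdGaussian (EuclideanSpace ℝ (GordonIndex ι κ))).map vecPart =
      stdGaussian (EuclideanSpace ℝ κ) := by
  have h := map_stdGaussian_of_orthonormal
    ((EuclideanSpace.basisFun (GordonIndex ι κ) ℝ).orthonormal.comp
      (fun b : κ => Sum.inr (Sum.inr (Sum.inl b))) (fun b b' hb => by simpa using hb))
  convert! h using 2
  ext G b
  simp [vecPart, EuclideanSpace.inner_single_left]

lemma map_vecPart' :
    (stdGaussian (EuclideanSpace ℝ (GordonIndex ι κ))).map vecPart' =
      stdGaussian (EuclideanSpace ℝ ι) := by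
  have h := map_stdGaussian_of_orthonormal
    ((EuclideanSpace.basisFun (GordonIndex ι κ) ℝ).orthonormal.comp
      (fun b : ι => Sum.inr (Sum.inr (Sum.inr b))) (fun b b' hb => by simpa using hb))
  convert! h using 2
  ext G b
  simp [vecPart', EuclideanSpace.inner_single_left]

/-- A matrix of coordinates along an orthonormal family is a Gaussian matrix. -/
lemma map_stdGaussian_eq_gaussianMatrix {m n : ℕ} {E : Type*} [NormedAddCommGroup E]
    [InnerProductSpace ℝ E] [FiniteDimensional ℝ E] [MeasurableSpace E] [BorelSpace E]
    {v : Fin m × Fin n → E} (hv : Orthonormal ℝ v) :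
    (stdGaussian E).map (fun G i j => inner ℝ (v (i, j)) G) = gaussianMatrix m n := by
  have hrow : ∀ i, (stdGaussian E).map (fun G j => inner ℝ (v (i, j)) G) =
      Measure.pi fun _ : Fin n => gaussianReal 0 1 := by
    intro i
    have h := map_stdGaussian_of_orthonormal (hv.comp (fun j : Fin n => (i, j))
      (Prod.mk_right_injective i))
    have h2 := congrArg (Measure.map (WithLp.ofLp (p := 2))) h
    rw [← map_pi_eq_stdGaussian, Measure.map_map (by fun_prop) (by fun_prop),
      Measure.map_map (by fun_prop) (by fun_prop)] at h2
    have h3 : (WithLp.ofLp (p := 2) : EuclideanSpace ℝ (Fin n) → _) ∘ WithLp.toLp 2 = id := rfl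
    rw [h3, Measure.map_id] at h2
    exact h2
  have hind : iIndepFun (fun i G j => inner ℝ (v (i, j)) G) (stdGaussian E) := by
    refine HasGaussianLaw.iIndepFun_of_covariance_eval (X := fun i j G => inner ℝ (v (i, j)) G)
      ?_ fun i i' hi j j' => ?_
    · let L : E →L[ℝ] (Fin m → Fin n → ℝ) :=
        ContinuousLinearMap.pi fun i => ContinuousLinearMap.pi fun j => innerSL ℝ (v (i, j))
      exact (IsGaussian.hasGaussianLaw_id (μ := stdGaussian E)).map L
    · rw [← covarianceBilin_apply_eq_cov IsGaussian.memLp_two_id, covarianceBilin_stdGaussian]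
      exact hv.2 (by simp [hi])
  rw [hind.map_fun_eq_pi_map fun i => by fun_prop, gaussianMatrix]
  congr 1
  exact funext hrow

lemma map_matrixPart (m n : ℕ) :
    (stdGaussian (EuclideanSpace ℝ (GordonIndex (Fin m) (Fin n)))).map
      (fun G i j => G (Sum.inl (i, j))) = gaussianMatrix m n := by
  have h := map_stdGaussian_eq_gaussianMatrix (m := m) (n := n)
    ((EuclideanSpace.basisFun (GordonIndex (Fin m) (Fin n)) ℝ).orthonormal.comp
      Sum.inl Sum.inl_injective)
  simpa [EuclideanSpace.inner_single_left] using h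

/-- When the comparison is indexed by multipliers in `ℝᵐ`, its matrix maps `ℝᵐ` to `ℝⁿ` and stands
for the transpose of `A`. -/
lemma map_matrixPart_transpose (m n : ℕ) :
    (stdGaussian (EuclideanSpace ℝ (GordonIndex (Fin n) (Fin m)))).map
      (fun G i j => G (Sum.inl (j, i))) = gaussianMatrix m n := by
  have h := map_stdGaussian_eq_gaussianMatrix (m := m) (n := n)
    ((EuclideanSpace.basisFun (GordonIndex (Fin n) (Fin m)) ℝ).orthonormal.comp
      (fun p : Fin m × Fin n => Sum.inl (p.2, p.1)) (fun p q h => by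
        simpa [Prod.ext_iff, and_comm] using h))
  simpa [EuclideanSpace.inner_single_left] using h

lemma measure_scalarPart_ge_le {t : ℝ} (ht : 0 < t) :
    (stdGaussian (EuclideanSpace ℝ (GordonIndex ι κ))).real {G | t ≤ scalarPart G} ≤ 1 / t ^ 2 := by
  have hL : LipschitzWith 1 (scalarPart : EuclideanSpace ℝ (GordonIndex ι κ) → ℝ) := by
    refine LipschitzWith.of_dist_le_mul fun x y => ?_
    rw [NNReal.coe_one, one_mul, dist_eq_norm x y]
    exact PiLp.norm_apply_le (x - y) _
  refine (measureReal_mono fun G hG => ?_).trans (measure_abs_sub_integral_ge_le hL ht)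
  have h0 : ∫ G, scalarPart G ∂(stdGaussian (EuclideanSpace ℝ (GordonIndex ι κ))) = 0 :=
    integral_strongDual_stdGaussian (E := EuclideanSpace ℝ (GordonIndex ι κ))
      (EuclideanSpace.proj (𝕜 := ℝ) (Sum.inr (Sum.inl ())))
  simp only [Set.mem_ofPred_eq, h0, sub_zero] at hG ⊢
  exact hG.trans (le_abs_self _)

end Laws

/-! ### Regularity of `xi` and weak duality -/

section Dual

variable {n : ℕ} {f : EuclideanSpace ℝ (Fin n) → ℝ}

/-- The inner maximum in the definition of `xi`. -/
noncomputable def xiAt (f : EuclideanSpace ℝ (Fin n) → ℝ) (l : ℝ)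
    (g : EuclideanSpace ℝ (Fin n)) : ℝ :=
  ⨆ w : unitSphere n, (inner ℝ g (w : EuclideanSpace ℝ (Fin n)) - l * f w)

lemma nonempty_unitSphere (hn : 0 < n) : Nonempty (unitSphere n) :=
  ⟨⟨EuclideanSpace.single ⟨0, hn⟩ 1, by simp [unitSphere]⟩⟩

lemma norm_eq_one (w : unitSphere n) : ‖(w : EuclideanSpace ℝ (Fin n))‖ = 1 := by
  simpa [unitSphere] using w.2

lemma exists_forall_le_of_lsc (hf : LowerSemicontinuousOn f (unitSphere n)) :
    ∃ c, ∀ w : unitSphere n, c ≤ f w := by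
  obtain ⟨c, hc⟩ := hf.bddBelow_of_isCompact (isCompact_sphere _ _)
  exact ⟨c, fun w => hc ⟨w, w.2, rfl⟩⟩

lemma bddAbove_xiAt (hf : LowerSemicontinuousOn f (unitSphere n)) {l : ℝ} (hl : 0 ≤ l)
    (g : EuclideanSpace ℝ (Fin n)) :
    BddAbove (Set.range fun w : unitSphere n =>
      inner ℝ g (w : EuclideanSpace ℝ (Fin n)) - l * f w) := by
  obtain ⟨c, hc⟩ := exists_forall_le_of_lsc hf
  refine ⟨‖g‖ - l * c, ?_⟩
  rintro _ ⟨w, rfl⟩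
  have h1 := real_inner_le_norm g (w : EuclideanSpace ℝ (Fin n))
  rw [norm_eq_one, mul_one] at h1
  have h2 := mul_le_mul_of_nonneg_left (hc w) hl
  simp only
  linarith

lemma xiAt_le_add (hn : 0 < n) (hf : LowerSemicontinuousOn f (unitSphere n)) {l : ℝ}
    (hl : 0 ≤ l) (g g' : EuclideanSpace ℝ (Fin n)) : xiAt f l g ≤ xiAt f l g' + dist g g' := by
  have := nonempty_unitSphere hn
  refine ciSup_le fun w => ?_
  have h1 := le_ciSup (bddAbove_xiAt hf hl g') w
  have h2 := real_inner_le_norm (g - g') (w : EuclideanSpace ℝ (Fin n))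
  rw [norm_eq_one, mul_one, inner_sub_left, ← dist_eq_norm] at h2
  simp only [xiAt] at h1 ⊢
  linarith

/-- A change of `g` moves every `xiAt` by at most `dist g g'`, so finiteness of the infimum over `l`
does not depend on `g`. The default value 0 of an unbounded infimum is therefore taken for all `g`
or for none. -/
lemma bddBelow_xiAt_of (hn : 0 < n) (hf : LowerSemicontinuousOn f (unitSphere n))
    {g : EuclideanSpace ℝ (Fin n)} (h : BddBelow (Set.range fun l : Set.Ici (0 : ℝ) => xiAt f l g))
    (g' : EuclideanSpace ℝ (Fin n)) :
    BddBelow (Set.range fun l : Set.Ici (0 : ℝ) => xiAt f l g') := by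
  obtain ⟨c, hc⟩ := h
  refine ⟨c - dist g g', ?_⟩
  rintro _ ⟨l, rfl⟩
  have h1 := hc ⟨l, rfl⟩
  have h2 := xiAt_le_add hn hf l.2 g g'
  simp only at h1 ⊢
  linarith

lemma xi_eq_zero_of_not_bddBelow {g : EuclideanSpace ℝ (Fin n)}
    (h : ¬ BddBelow (Set.range fun l : Set.Ici (0 : ℝ) => xiAt f l g)) : xi f g = 0 :=
  Real.sInf_of_not_bddBelow h

/-- `xi f` is `1`-Lipschitz, so that it concentrates around its mean at a constant scale without
any further hypothesis on `f`. -/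
lemma lipschitzWith_xi (hn : 0 < n) (hf : LowerSemicontinuousOn f (unitSphere n)) :
    LipschitzWith 1 (xi f) := by
  refine LipschitzWith.of_le_add fun g g' => ?_
  by_cases h : BddBelow (Set.range fun l : Set.Ici (0 : ℝ) => xiAt f l g)
  · rw [← sub_le_iff_le_add]
    refine le_ciInf fun l => ?_
    have h1 : xi f g ≤ xiAt f l g := ciInf_le h l
    have h2 := xiAt_le_add hn hf l.2 g g'
    change _ ≤ xiAt f l g'
    linarith
  · rw [xi_eq_zero_of_not_bddBelow h, xi_eq_zero_of_not_bddBelow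
      fun h' => h (bddBelow_xiAt_of hn hf h' g), zero_add]
    exact dist_nonneg

/-- Weak duality: at a point of the mesh the penalty `-l f(w)` is nonnegative for every `l ≥ 0`. -/
lemma inner_le_xi (hf : LowerSemicontinuousOn f (unitSphere n))
    {w : EuclideanSpace ℝ (Fin n)} (hw : w ∈ meshSet f) (g : EuclideanSpace ℝ (Fin n)) :
    inner ℝ g w ≤ xi f g := by
  refine le_ciInf fun l => le_trans ?_ (le_ciSup (bddAbove_xiAt hf l.2 g) ⟨w, hw.1⟩)
  have := mul_nonpos_of_nonneg_of_nonpos (Set.mem_Ici.1 l.2) hw.2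
  simp only
  linarith

/-- Only the default value of an unbounded infimum could break this, and then `xi f` would vanish
identically, against the positive mean. -/
lemma xi_le_xiAt (hn : 0 < n) (hf : LowerSemicontinuousOn f (unitSphere n)) (h0 : 0 < xiD f)
    {l : ℝ} (hl : 0 ≤ l) (g : EuclideanSpace ℝ (Fin n)) : xi f g ≤ xiAt f l g := by
  by_cases h : BddBelow (Set.range fun l : Set.Ici (0 : ℝ) => xiAt f l g)
  · exact ciInf_le h ⟨l, hl⟩
  · exfalso
    have h1 : ∀ g', xi f g' = 0 := fun g' =>
      xi_eq_zero_of_not_bddBelow fun h' => h (bddBelow_xiAt_of hn hf h' g)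
    simp [xiD, h1] at h0

end Dual

/-! ### Transfer of probability bounds -/

section Events

variable {ι κ : Type*} [Fintype ι] [Fintype κ] [DecidableEq ι] [DecidableEq κ]

omit [DecidableEq κ] in
lemma measureReal_abs_sub_comp_ge_le {E : Type*} [NormedAddCommGroup E] [InnerProductSpace ℝ E]
    [FiniteDimensional ℝ E] [MeasurableSpace E] [BorelSpace E] {X : E → EuclideanSpace ℝ ι}
    (hX : Continuous X)
    (hlaw : (stdGaussian E).map X = stdGaussian (EuclideanSpace ℝ ι))
    {F : EuclideanSpace ℝ ι → ℝ} (hF : LipschitzWith 1 F) {t : ℝ} (ht : 0 < t) :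
    (stdGaussian E).real
      {G | t ≤ |F (X G) - ∫ y, F y ∂(stdGaussian (EuclideanSpace ℝ ι))|} ≤ 1 / t ^ 2 := by
  have h := measure_abs_sub_integral_ge_le hF ht
  rw [← hlaw, map_measureReal_apply hX.measurable, hlaw] at h
  · exact h
  · exact (isClosed_le continuous_const
      (hF.continuous.sub continuous_const).abs).measurableSet

/-- A lower bound for the probability of the decoupled event and of its bilinear counterpart. -/
lemma one_sub_le_measure_bilinear {w : ℕ → EuclideanSpace ℝ κ} (hw : ∀ j, ‖w j‖ = 1)
    {ψ : ℕ → EuclideanSpace ℝ ι → ℝ} (hψ : ∀ j, LipschitzWith 1 (ψ j))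
    {F : EuclideanSpace ℝ κ → ℝ} (hF : LipschitzWith 1 F)
    {H : EuclideanSpace ℝ ι → ℝ} (hH : LipschitzWith 1 H) {t : ℝ} (ht : 0 < t)
    (h : ∀ x y, |F x - ∫ x, F x ∂(stdGaussian (EuclideanSpace ℝ κ))| < t →
      |H y - ∫ y, H y ∂(stdGaussian (EuclideanSpace ℝ ι))| < t → ∀ j, ψ j y ≤ inner ℝ (w j) x) :
    1 - 3 / t ^ 2 ≤ (stdGaussian (EuclideanSpace ℝ (GordonIndex ι κ))).real
      {G | (∀ j, ψ j (matApply G (w j)) - 3 ≤ scalarPart G) ∧ scalarPart G < t} := by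
  set γ := stdGaussian (EuclideanSpace ℝ (GordonIndex ι κ)) with hγ
  set S₁ := {G : EuclideanSpace ℝ (GordonIndex ι κ) |
    t ≤ |F (vecPart G) - ∫ x, F x ∂(stdGaussian (EuclideanSpace ℝ κ))|} with hS₁
  set S₂ := {G : EuclideanSpace ℝ (GordonIndex ι κ) |
    t ≤ |H (vecPart' G) - ∫ x, H x ∂(stdGaussian (EuclideanSpace ℝ ι))|} with hS₂
  set P := {G : EuclideanSpace ℝ (GordonIndex ι κ) |
    ∀ j, ψ j (vecPart' G) ≤ inner ℝ (w j) (vecPart G)} with hP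
  set Q := {G : EuclideanSpace ℝ (GordonIndex ι κ) |
    ∀ j, ψ j (matApply G (w j)) - 3 ≤ scalarPart G} with hQ
  set Z := {G : EuclideanSpace ℝ (GordonIndex ι κ) | t ≤ scalarPart G} with hZ
  set R := {G : EuclideanSpace ℝ (GordonIndex ι κ) |
    (∀ j, ψ j (matApply G (w j)) - 3 ≤ scalarPart G) ∧ scalarPart G < t} with hR
  -- Three Chebyshev failures, for `F`, for `H` and for the scalar, add up to `3 / t ^ 2`.
  have h1 : γ.real S₁ ≤ 1 / t ^ 2 :=
    measureReal_abs_sub_comp_ge_le continuous_vecPart map_vecPart hF ht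
  have h2 : γ.real S₂ ≤ 1 / t ^ 2 :=
    measureReal_abs_sub_comp_ge_le continuous_vecPart' map_vecPart' hH ht
  have h3 : γ.real Z ≤ 1 / t ^ 2 := measure_scalarPart_ge_le ht
  have h4 : γ.real P ≤ γ.real Q := measure_decoupled_le_measure_bilinear_seq hw hψ
  have h5 : γ.real Set.univ ≤ γ.real (S₁ ∪ S₂ ∪ P) := by
    refine measureReal_mono fun G _ => ?_
    by_cases hG1 : G ∈ S₁
    · exact Or.inl (Or.inl hG1)
    by_cases hG2 : G ∈ S₂
    · exact Or.inl (Or.inr hG2)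
    · exact Or.inr (h _ _ (not_le.1 hG1) (not_le.1 hG2))
  have h6 : γ.real Q ≤ γ.real (Z ∪ R) := by
    refine measureReal_mono fun G hG => ?_
    rcases le_or_gt t (scalarPart G) with hz | hz
    · exact Or.inl hz
    · exact Or.inr ⟨hG, hz⟩
  have h7 := measureReal_union_le (μ := γ) Z R
  have h8 := measureReal_union_le (μ := γ) (S₁ ∪ S₂) P
  have h9 := measureReal_union_le (μ := γ) S₁ S₂
  rw [probReal_univ] at h5
  have : 3 / t ^ 2 = 1 / t ^ 2 + 1 / t ^ 2 + 1 / t ^ 2 := by ring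
  linarith

end Events

/-! ### The null space misses or meets the mesh -/

section Escape

variable {m n : ℕ} {f : EuclideanSpace ℝ (Fin n) → ℝ}

/-- The set `s` is arbitrary: one inequality suffices for lower bounds and avoids proving the null
space events measurable. -/
lemma measureReal_preimage_le {Ω : Type*} [MeasurableSpace Ω] {μ : Measure Ω}
    {X : Ω → Fin m → Fin n → ℝ} (hX : Measurable X) (hlaw : μ.map X = gaussianMatrix m n)
    [IsProbabilityMeasure μ] (s : Set (Fin m → Fin n → ℝ)) :
    μ.real (X ⁻¹' s) ≤ (gaussianMatrix m n).real s := by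
  rw [← hlaw]
  have := Measure.isProbabilityMeasure_map (μ := μ) hX.aemeasurable
  exact ENNReal.toReal_mono (measure_ne_top _ _) (Measure.le_map_apply hX.aemeasurable s)

lemma matApply_eq_toEuclideanLin (G : EuclideanSpace ℝ (GordonIndex (Fin m) (Fin n)))
    (w : EuclideanSpace ℝ (Fin n)) :
    matApply G w = Matrix.toEuclideanLin (Matrix.of fun i j => G (Sum.inl (i, j))) w := by
  ext i
  simp [matApply, Matrix.mulVec, dotProduct, mul_comm]

lemma inner_matApply_transpose (G : EuclideanSpace ℝ (GordonIndex (Fin n) (Fin m)))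
    (u : EuclideanSpace ℝ (Fin m)) (w : EuclideanSpace ℝ (Fin n)) :
    inner ℝ (matApply G u) w =
      inner ℝ u (Matrix.toEuclideanLin (Matrix.of fun i j => G (Sum.inl (j, i))) w) := by
  simp only [matApply, PiLp.inner_apply, Matrix.toLpLin_apply, Matrix.mulVec, dotProduct,
    Matrix.of_apply, RCLike.inner_apply, conj_trivial, Finset.mul_sum, Finset.sum_mul]
  rw [Finset.sum_comm]
  refine Finset.sum_congr rfl fun i _ => Finset.sum_congr rfl fun j _ => ?_
  ring

/-- A random null space misses a set of small width with large probability. -/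
theorem one_sub_le_measure_disjoint (hn : 0 < n) (hf : LowerSemicontinuousOn f (unitSphere n))
    {t : ℝ} (ht : 0 < t) (h : xiD f + (3 * t + 4) ≤ √m) :
    1 - 3 / t ^ 2 ≤ (gaussianMatrix m n).real
      {a | (nullSpace (Matrix.of a) : Set (EuclideanSpace ℝ (Fin n))) ∩ meshSet f = ∅} := by
  have hprob : IsProbabilityMeasure (gaussianMatrix m n) := by
    unfold gaussianMatrix; infer_instance
  rcases (meshSet f).eq_empty_or_nonempty with hS | hS
  · simp only [hS, Set.inter_empty]
    have : (gaussianMatrix m n).real {a | True} = 1 := probReal_univ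
    simp only [this]
    have : 0 ≤ 3 / t ^ 2 := by positivity
    linarith
  have := hS.to_subtype
  obtain ⟨d, hd⟩ := TopologicalSpace.exists_dense_seq (meshSet f)
  have hnorm : ∀ w ∈ meshSet f, ‖w‖ = 1 := fun w hw => by simpa [unitSphere] using hw.1
  -- With the sign reversed, the decoupled event reads `⟪d j, g⟫ + t + 3 ≤ ‖h‖` and the bilinear one
  -- `t - z ≤ ‖A (d j)‖`, where `z < t`.
  have key := one_sub_le_measure_bilinear (ι := Fin m) (κ := Fin n) (w := fun j => -(d j).1)
    (fun j => by rw [norm_neg]; exact hnorm _ (d j).2)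
    (ψ := fun _ x => (t + 3) - ‖x‖)
    (fun _ => LipschitzWith.of_le_add fun x y => by
      have h1 := norm_sub_norm_le y x
      rw [← dist_eq_norm, dist_comm] at h1
      linarith)
    (lipschitzWith_xi hn hf) (H := fun x => ‖x‖) lipschitzWith_one_norm ht ?_
  · refine key.trans (le_trans (measureReal_mono ?_) (measureReal_preimage_le
      (μ := stdGaussian (EuclideanSpace ℝ (GordonIndex (Fin m) (Fin n))))
      (by fun_prop) (map_matrixPart m n) _))
    rintro G ⟨hG, hz⟩
    simp only [Set.mem_preimage, Set.mem_ofPred_eq]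
    rw [Set.eq_empty_iff_forall_notMem]
    rintro w ⟨hw0, hw⟩
    have hclosed : IsClosed {v : meshSet f | t - scalarPart G ≤ ‖matApply G v.1‖} := by
      simp_rw [matApply_eq_toEuclideanLin]
      refine isClosed_le continuous_const (Continuous.norm ?_)
      exact (LinearMap.continuous_of_finiteDimensional _).comp continuous_subtype_val
    -- The positive lower bound `t - z` does not depend on `j`, so it survives the passage from the
    -- dense sequence to the whole mesh.
    have hall := hd.induction_on (p := fun v : meshSet f =>
      t - scalarPart G ≤ ‖matApply G v.1‖) ⟨w, hw⟩ hclosed fun j => by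
        have h1 := hG j
        rw [matApply_eq_toEuclideanLin, map_neg, norm_neg, ← matApply_eq_toEuclideanLin] at h1
        linarith
    have hw0' : Matrix.toEuclideanLin (Matrix.of fun i j => G (Sum.inl (i, j))) w = 0 := hw0
    simp only [matApply_eq_toEuclideanLin, hw0', norm_zero] at hall
    linarith
  -- Budget `3t + 4`: a deviation `t` for each of `ξ` and the norm, the margin `t + 3`, and 1
  -- because the mean norm is only known to be at least `√m - 1`.
  · intro x y hx hy j
    have h1 := (integral_norm_stdGaussian_bounds (ι := Fin m)).1
    rw [Fintype.card_fin] at h1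
    have h2 := inner_le_xi hf (d j).2 x
    rw [inner_neg_left, real_inner_comm]
    have h3 := (abs_lt.1 hx).2
    have h4 := (abs_lt.1 hy).1
    change xi f x - xiD f < t at h3
    linarith

/-- If the inner infimum at `ν` were `δ > 0`, some `μ` in the dense set close to `-ν` would give `w`
with `f w + ⟪ν, A w⟫ < ⟪μ + ν, A w⟫ < δ`, a contradiction. -/
lemma tauDual_nonpos {A : Matrix (Fin m) (Fin n) ℝ} (hn : 0 < n)
    (hf : LowerSemicontinuousOn f (unitSphere n)) {s : Set (EuclideanSpace ℝ (Fin m))}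
    (hs : Dense s)
    (h : ∀ ν ∈ s, ∃ w : unitSphere n, f w < inner ℝ ν (Matrix.toEuclideanLin A w)) :
    tauDual f A ≤ 0 := by
  have := nonempty_unitSphere hn
  obtain ⟨c, hc⟩ := exists_forall_le_of_lsc hf
  set T := LinearMap.toContinuousLinearMap (Matrix.toEuclideanLin A) with hT
  have hTn : ∀ (μ : EuclideanSpace ℝ (Fin m)) (w : unitSphere n),
      |inner ℝ μ (Matrix.toEuclideanLin A w)| ≤ ‖μ‖ * ‖T‖ := by
    intro μ w
    refine (abs_real_inner_le_norm _ _).trans (mul_le_mul_of_nonneg_left ?_ (norm_nonneg _))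
    have := T.le_opNorm (w : EuclideanSpace ℝ (Fin n))
    rwa [norm_eq_one, mul_one] at this
  refine ciSup_le fun ν => ?_
  by_contra! hpos
  set δ := ⨅ w : unitSphere n,
    (f w + inner ℝ ν (Matrix.toEuclideanLin A (w : EuclideanSpace ℝ (Fin n)))) with hδ
  have hbdd : BddBelow (Set.range fun w : unitSphere n =>
      f w + inner ℝ ν (Matrix.toEuclideanLin A (w : EuclideanSpace ℝ (Fin n)))) := by
    refine ⟨c - ‖ν‖ * ‖T‖, ?_⟩
    rintro _ ⟨w, rfl⟩
    have h1 := (abs_le.1 (hTn ν w)).1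
    have h2 := hc w
    simp only
    linarith
  obtain ⟨μ, hμs, hμ⟩ := hs.exists_dist_lt (-ν) (ε := δ / (‖T‖ + 1)) (by positivity)
  obtain ⟨w, hw⟩ := h μ hμs
  have h1 := ciInf_le hbdd w
  have h2 := (abs_le.1 (hTn (μ + ν) w)).2
  have h3 : ‖μ + ν‖ * (‖T‖ + 1) < δ := by
    rw [dist_comm, dist_eq_norm, sub_neg_eq_add] at hμ
    exact (lt_div_iff₀ (by positivity)).1 hμ
  rw [inner_add_left] at h2
  have h4 := norm_nonneg (μ + ν)
  simp only [← hδ] at h1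
  nlinarith

/-- As `m < n`, the kernel meets the sphere in a nonempty compact set, where a lower semicontinuous
function attains its minimum. -/
lemma nonempty_inter_of_tau_nonpos {A : Matrix (Fin m) (Fin n) ℝ} (hmn : m < n)
    (hf : LowerSemicontinuousOn f (unitSphere n)) (h : tau f A ≤ 0) :
    ((nullSpace A : Set (EuclideanSpace ℝ (Fin n))) ∩ meshSet f).Nonempty := by
  set K : Set (EuclideanSpace ℝ (Fin n)) := {w | w ∈ unitSphere n ∧ w ∈ nullSpace A} with hK
  have hKs : K ⊆ unitSphere n := fun w hw => hw.1
  have hKc : IsCompact K :=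
    (isCompact_sphere (0 : EuclideanSpace ℝ (Fin n)) 1).inter_right
      (nullSpace A).closed_of_finiteDimensional
  have hKne : K.Nonempty := by
    have h1 : nullSpace A ≠ ⊥ := LinearMap.ker_ne_bot_of_finrank_lt (by simpa using hmn)
    obtain ⟨v, hv, hv0⟩ := Submodule.exists_mem_ne_zero_of_ne_bot h1
    refine ⟨‖v‖⁻¹ • v, ?_, (nullSpace A).smul_mem _ hv⟩
    simp [unitSphere, norm_smul, inv_mul_cancel₀ (norm_ne_zero_iff.2 hv0)]
  obtain ⟨w, hw, hmin⟩ := (hf.mono hKs).exists_isMinOn hKne hKc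
  have hτ : tau f A = f w := by
    refine IsLeast.csInf_eq ⟨⟨w, hw, rfl⟩, ?_⟩
    rintro _ ⟨v, hv, rfl⟩
    exact hmin hv
  exact ⟨w, hw.2, hw.1, hτ ▸ h⟩

/-- A random null space meets a set of large dual width with large probability, if minimax
duality holds. -/
theorem one_sub_le_measure_nonempty (hm : 0 < m) (hmn : m < n)
    (hf : LowerSemicontinuousOn f (unitSphere n)) (hdual : SignDuality m f)
    {t : ℝ} (ht : 0 < t) (h : √m + (3 * t + 3) ≤ xiD f) :
    1 - 3 / t ^ 2 ≤ (gaussianMatrix m n).real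
      {a | ((nullSpace (Matrix.of a) : Set (EuclideanSpace ℝ (Fin n))) ∩ meshSet f).Nonempty} := by
  have hprob : IsProbabilityMeasure (gaussianMatrix m n) := by
    unfold gaussianMatrix; infer_instance
  have hn : 0 < n := hm.trans hmn
  have hpos : 0 < xiD f := by
    have := Real.sqrt_nonneg (m : ℝ)
    linarith
  have : Nonempty (Fin m) := ⟨⟨0, hm⟩⟩
  -- Multipliers are to be normalised, so zero is removed; since `m > 0` the remaining set is still
  -- dense.
  have hdense : Dense ({0}ᶜ : Set (EuclideanSpace ℝ (Fin m))) := dense_compl_singleton 0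
  have := hdense.nonempty.to_subtype
  obtain ⟨d, hd⟩ := TopologicalSpace.exists_dense_seq ({0}ᶜ : Set (EuclideanSpace ℝ (Fin m)))
  have hd0 : ∀ j, 0 < ‖(d j).1‖ := fun j => norm_pos_iff.2 (d j).2
  have hD : Dense (Set.range fun j => (d j).1) :=
    hdense.denseRange_val.comp hd continuous_subtype_val
  have hu : ∀ j, ‖‖(d j).1‖⁻¹ • (d j).1‖ = 1 := fun j => by
    rw [norm_smul, norm_inv, norm_norm, inv_mul_cancel₀ (hd0 j).ne']
  -- Division of `f w < ⟪ν, A w⟫` by `‖ν‖` turns it into positivity of `xiAt` at `l = 1 / ‖ν‖`,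
  -- evaluated at the transposed matrix applied to a unit vector.
  have key := one_sub_le_measure_bilinear (ι := Fin n) (κ := Fin m)
    (w := fun j => ‖(d j).1‖⁻¹ • (d j).1) hu
    (ψ := fun j x => (t + 3) - xiAt f ‖(d j).1‖⁻¹ x)
    (fun j => LipschitzWith.of_le_add fun x y => by
      have h1 := xiAt_le_add hn hf (inv_nonneg.2 (hd0 j).le) y x
      rw [dist_comm] at h1
      linarith)
    (F := fun x => ‖x‖) lipschitzWith_one_norm (lipschitzWith_xi hn hf) ht ?_
  · refine key.trans (le_trans (measureReal_mono (s₂ := (fun G i j => G (Sum.inl (j, i))) ⁻¹'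
      {a : Fin m → Fin n → ℝ | tauDual f (Matrix.of a) ≤ 0}) ?_)
      ((measureReal_preimage_le
      (μ := stdGaussian (EuclideanSpace ℝ (GordonIndex (Fin n) (Fin m))))
      (by fun_prop) (map_matrixPart_transpose m n) _).trans ?_))
    · rintro G ⟨hG, hz⟩
      refine tauDual_nonpos hn hf hD ?_
      rintro _ ⟨j, rfl⟩
      have := nonempty_unitSphere hn
      have h1 : 0 < xiAt f ‖(d j).1‖⁻¹ (matApply G (‖(d j).1‖⁻¹ • (d j).1)) := by
        have := hG j
        linarith
      obtain ⟨w, hw⟩ := exists_lt_of_lt_ciSup h1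
      refine ⟨w, ?_⟩
      rw [inner_matApply_transpose, real_inner_smul_left, ← mul_sub] at hw
      have := (mul_pos_iff_of_pos_left (inv_pos.2 (hd0 j))).1 hw
      linarith
    -- A positive `tau` would make `tauDual` positive as well, by sign duality.
    · refine ENNReal.toReal_mono (measure_ne_top _ _) (measure_mono_ae ?_)
      filter_upwards [hdual] with a ha hle
      refine nonempty_inter_of_tau_nonpos hmn hf ?_
      by_contra! hτ
      rw [sign_pos hτ] at ha
      exact absurd (sign_eq_one_iff.1 ha.symm) (not_lt.2 hle)
  -- Every `xiAt` dominates `xi`, so the single deviation bound for `xi` serves all multipliers. The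
  -- budget is `3t + 3`, as the mean norm is at most `√m` without loss.
  · intro x y hx hy j
    have h1 := (integral_norm_stdGaussian_bounds (ι := Fin m)).2
    rw [Fintype.card_fin] at h1
    have h2 := xi_le_xiAt hn hf hpos (inv_nonneg.2 (hd0 j).le) y
    have h3 := (abs_lt.1 hx).2
    have h4 := (abs_lt.1 hy).1
    have h5 := (abs_le.1 (abs_real_inner_le_norm (‖(d j).1‖⁻¹ • (d j).1) x)).1
    rw [hu, one_mul] at h5
    change -t < xi f y - xiD f at h4
    linarith

lemma tendsto_one_of_one_sub_le {p t : ℕ → ℝ} (ht : Tendsto t atTop atTop)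
    (hp : ∀ᶠ n in atTop, 1 - 3 / t n ^ 2 ≤ p n) (hp1 : ∀ n, p n ≤ 1) :
    Tendsto p atTop (𝓝 1) := by
  have h : Tendsto (fun n => 1 - 3 / t n ^ 2) atTop (𝓝 1) := by
    simpa using (((tendsto_pow_atTop two_ne_zero).comp ht).const_div_atTop 3).const_sub 1
  exact tendsto_of_tendsto_of_tendsto_of_le_of_le' h tendsto_const_nhds hp
    (Eventually.of_forall hp1)

end Escape

end Mesh

/-! ### The two limits -/

theorem theorem3
    (m : ℕ → ℕ) (f : (n : ℕ) → EuclideanSpace ℝ (Fin n) → ℝ)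
    (hlt : ∀ᶠ n : ℕ in atTop, m n < n)
    (hprop : ∃ c : ℝ, 0 < c ∧ ∀ᶠ n : ℕ in atTop, c * (n : ℝ) ≤ (m n : ℝ))
    (hf : ∀ᶠ n : ℕ in atTop, LowerSemicontinuousOn (f n) (Mesh.unitSphere n))
    (hdual : ∀ᶠ n : ℕ in atTop, Mesh.SignDuality (m n) (f n))
    (hconc : Mesh.XiConcentrates f) :
    (∀ ε₁ ε₂ : ℝ, 0 < ε₁ → 0 < ε₂ →
      (∀ᶠ n : ℕ in atTop,
        (1 + ε₁) * Real.sqrt (m n) + ε₂ * Real.sqrt n ≤ Mesh.xiD (f n)) →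
      Tendsto (fun n : ℕ => (Mesh.gaussianMatrix (m n) n).real
        {a | ((Mesh.nullSpace (Matrix.of a) : Set (EuclideanSpace ℝ (Fin n))) ∩
          Mesh.meshSet (f n)).Nonempty}) atTop (𝓝 1)) ∧
    (Tendsto (fun n : ℕ =>
        (Real.sqrt (m n) - 1 / (4 * Real.sqrt (m n))) - Mesh.xiD (f n)) atTop atTop →
      Tendsto (fun n : ℕ => (Mesh.gaussianMatrix (m n) n).real
        {a | (Mesh.nullSpace (Matrix.of a) : Set (EuclideanSpace ℝ (Fin n))) ∩
          Mesh.meshSet (f n) = ∅}) atTop (𝓝 1)) := by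
  have hprob : ∀ n, IsProbabilityMeasure (Mesh.gaussianMatrix (m n) n) := fun n => by
    unfold Mesh.gaussianMatrix; infer_instance
  constructor
  · intro ε₁ ε₂ h₁ h₂ hξ
    obtain ⟨c, hc, hcm⟩ := hprop
    -- Chosen so that `3t + 3 = ε₂ √n`; the term `ε₁ √m` is then discarded as nonnegative.
    have ht : Tendsto (fun n : ℕ => (ε₂ * Real.sqrt n - 3) / 3) atTop atTop :=
      (tendsto_atTop_add_const_right _ (-3)
        ((Real.tendsto_sqrt_atTop.comp tendsto_natCast_atTop_atTop).const_mul_atTop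
          h₂)).atTop_div_const three_pos
    refine Mesh.tendsto_one_of_one_sub_le ht ?_ fun n => measureReal_le_one
    filter_upwards [hlt, hf, hdual, hξ, hcm, ht.eventually_gt_atTop 0, eventually_gt_atTop 0]
      with n hmn hfn hdn hξn hcn htn hn
    have hm : 0 < m n := by
      have : (0 : ℝ) < m n := (mul_pos hc (Nat.cast_pos.2 hn)).trans_le hcn
      exact_mod_cast this
    refine Mesh.one_sub_le_measure_nonempty hm hmn hfn hdn htn ?_
    have := mul_nonneg h₁.le (Real.sqrt_nonneg (m n : ℝ))
    linarith
  · intro hgap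
    -- Here `3t + 4` equals the gap, and the correction `1 / (4 √m)` only helps.
    have ht := (tendsto_atTop_add_const_right _ (-4) hgap).atTop_div_const (three_pos (α := ℝ))
    refine Mesh.tendsto_one_of_one_sub_le ht ?_ fun n => measureReal_le_one
    filter_upwards [hf, ht.eventually_gt_atTop 0, eventually_gt_atTop 0] with n hfn htn hn
    refine Mesh.one_sub_le_measure_disjoint hn hfn htn ?_
    have : 0 ≤ 1 / (4 * Real.sqrt (m n)) := by positivity
    linarith
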